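/- **Theorem (explicit $\mathsf B^{(K)}$-eigenbasis).** *Setting.* Let $\mathsf N\ge 0$, let $2s_1,\dots,2s_{\mathsf N}$ be positive integers, $\eta\in\mathbb C\setminus\{0\}$ and $\xi_1,\dots,\xi_{\mathsf N}\in\mathbb C$. On $V_n=\mathbb C^{2s_n+1}$ put $S^z_n=\mathrm{diag}(s_n,s_n-1,\dots,-s_n)$, let $S_n^+$ be the matrix whose only nonzero entries are the superdiagonal ones $x_n(j)=\sqrt{j(2s_n+1-j)}$, $j=1,\dots,2s_n$, and let $S_n^-=(S_n^+)^t$. Let $\mathcal H=\bigotimes_{n=1}^{\mathsf N}V_n$ and $$\mathsf L_{0n}(\lambda)=\begin{pmatrix}\lambda+\eta(\tfrac12+S^z_n)&\eta S^-_n\\ \eta S^+_n&\lambda+\eta(\tfrac12-S^z_n)\end{pmatrix}.$$ For $K\in\mathrm{End}(\mathbb C^2)$ put $$\mathsf M^{(K)}(\lambda)=\begin{pmatrix}\mathsf A^{(K)}(\lambda)&\mathsf B^{(K)}(\lambda)\\ \mathsf C^{(K)}(\lambda)&\mathsf D^{(K)}(\lambda)\end{pmatrix}=K_0\,\mathsf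 L_{0\mathsf N}(\lambda-\xi_{\mathsf N})\cdots\mathsf L_{01}(\lambda-\xi_1).$$ Put $\xi_n^-=\xi_n-\eta/2$, $a(\lambda)=\prod_n(\lambda-\xi_n^-+s_n\eta)$, $d(\lambda)=\prod_n(\lambda-\xi_n^--s_n\eta)$, $\xi_n^{(k)}=\xi_n^-+(s_n-k)\eta$. Assume $\xi_a-\xi_b\notin\eta\mathbb Z$ for $a\ne b$ and that the strings $\{\xi_n^{(k)}:0\le k\le 2s_n\}$, $n=1,\dots,\mathsf N$, are pairwise disjoint (when all $2s_n$ have the same parity the second condition follows from the first). Let $K=\begin{pmatrix}a&b\\c&d\end{pmatrix}$ be invertible and not proportional to the identity, with eigenvalues $\mathsf k_1,\mathsf k_2$ (counted with multiplicity, in either order). Let $\langle 0|=\bigotimes_n(1,0,\dots,0)$, let $\textsc n=\prod_{b<a}(\xi_a^{(0)}-\xi_b^{(0)})^{1/2}$ (principal square roots), and for $\mathbf h=(h_1,\dots,h_{\mathsf N})$ with $0\le h_n\le 2s_n$ define $$\langle\mathbf h|_{Sk}=\frac1{\textsc n}\langle0|\prod_{n=1}^{\mathsf N}\prod_{k=0}^{h_n-1}\frac{\mathsf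 A^{(K)}(\xi_n^{(k)})}{\mathsf k_1\,a(\xi_n^{(k)})},$$ the factors being ordered from left to right by increasing $n$, then increasing $k$. By convention the covector is $0$ if some $h_n\notin\{0,\dots,2s_n\}$; $\langle\mathbf h|_{Sk}\mathrm T_a^{\pm}$ denotes the covector with $h_a$ replaced by $h_a\pm1$. **a)** If $b\neq0$, the covectors $\langle\mathbf h|_{Sk}$ form a basis of the space of covectors on $\mathcal H$, and for all $\mathbf h$ and $\lambda$ $$\langle\mathbf h|_{Sk}\mathsf B^{(K)}(\lambda)=d^{(K)}_{\mathbf h}(\lambda)\langle\mathbf h|_{Sk},\qquad d^{(K)}_{\mathbf h}(\lambda)=b\prod_{n}(\lambda-\xi_n^{(h_n)}),$$ where the functions $d^{(K)}_{\mathbf h}$ are pairwise distinct. Moreover $$\langle\mathbf h|_{Sk}\mathsf A^{(K)}(\lambda)=a\prod_n(\lambda-\xi_n^{(h_n)})\,\langle\mathbf h|_{Sk}+\sum_{r=1}^{\mathsf N}\prod_{q\ne r}\frac{\lambda-\xi_q^{(h_q)}}{\xi_r^{(h_r)}-\xi_q^{(h_q)}}\,\mathsf k_1\,a(\xi_r^{(h_r)})\,\langle\mathbf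 h|_{Sk}\mathrm T_r^{+},$$ $$\langle\mathbf h|_{Sk}\mathsf D^{(K)}(\lambda)=d\prod_n(\lambda-\xi_n^{(h_n)})\,\langle\mathbf h|_{Sk}+\sum_{r=1}^{\mathsf N}\prod_{q\ne r}\frac{\lambda-\xi_q^{(h_q)}}{\xi_r^{(h_r)}-\xi_q^{(h_q)}}\,\mathsf k_2\,d(\xi_r^{(h_r)})\,\langle\mathbf h|_{Sk}\mathrm T_r^{-}$$ (without argument, $a$ and $d$ are the entries of $K$; with an argument, the functions above). The family $\mathsf C^{(K)}$ satisfies $\mathsf A^{(K)}(\lambda)\mathsf D^{(K)}(\lambda-\eta)-\mathsf B^{(K)}(\lambda)\mathsf C^{(K)}(\lambda-\eta)=\det K\,a(\lambda)d(\lambda-\eta)$ for all $\lambda$, and it is the only family of operators continuous in $\lambda$ that does. **b)** Let $b=0$. There is an invertible $W\in\mathrm{End}(\mathbb C^2)$ such that both off-diagonal entries of $W^{-1}KW$ are nonzero. Let $W$ be any invertible matrix such that the upper right entry $\bar b$ of $\bar K=W^{-1}KW=\begin{pmatrix}\bar a&\bar b\\ \bar c&\bar d\end{pmatrix}$ is nonzero.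 Let $\mathcal W=\bigotimes_nW_n^{(2s_n)}$, where $W^{(q)}$ is the restriction of $W^{\otimes q}$ to the symmetric subspace of $(\mathbb C^2)^{\otimes q}$, identified with $\mathbb C^{q+1}$ through its orthonormal weight basis (number of second basis vectors $0,1,\dots,q$). Let $E_{ij}$ be the $2\times2$ matrix units and $$\tilde{\mathsf A}^{(K)}=\mathrm{tr}_0[W_0(E_{11})_0W_0^{-1}\mathsf M_0^{(K)}],\quad \tilde{\mathsf B}^{(K)}=\mathrm{tr}_0[W_0(E_{21})_0W_0^{-1}\mathsf M_0^{(K)}],\quad \tilde{\mathsf D}^{(K)}=\mathrm{tr}_0[W_0(E_{22})_0W_0^{-1}\mathsf M_0^{(K)}].$$ Then the covectors $$\underline{\langle\mathbf h|}_{Sk}=\frac1{\textsc n}\langle0|\prod_{n=1}^{\mathsf N}\prod_{k=0}^{h_n-1}\frac{\mathsf A^{(\bar K)}(\xi_n^{(k)})}{\mathsf k_1a(\xi_n^{(k)})}\,\mathcal W^{-1}=\frac1{\textsc n}\langle0|\mathcal W^{-1}\prod_{n=1}^{\mathsf N}\prod_{k=0}^{h_n-1}\frac{\tilde{\mathsf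 A}^{(K)}(\xi_n^{(k)})}{\mathsf k_1a(\xi_n^{(k)})}$$ (the two expressions agree) form a basis of the space of covectors on $\mathcal H$, and $\underline{\langle\mathbf h|}_{Sk}\tilde{\mathsf B}^{(K)}(\lambda)=\bar b\prod_n(\lambda-\xi_n^{(h_n)})\,\underline{\langle\mathbf h|}_{Sk}$ with pairwise distinct eigenvalues. The operators $\tilde{\mathsf A}^{(K)}(\lambda)$ and $\tilde{\mathsf D}^{(K)}(\lambda)$ act on $\underline{\langle\mathbf h|}_{Sk}$ by the formulas of part a) with the entries $a,d$ of $K$ replaced by $\bar a,\bar d$ (the functions $a(\cdot)$, $d(\cdot)$ and the numbers $\mathsf k_1,\mathsf k_2$ unchanged). -/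

import Mathlib

open scoped Matrix

noncomputable section

namespace HigherSpin

/-- Labels of the natural basis of `H = ⨂ₙ V_n`, where `V_n = ℂ^(2 sₙ + 1)` and `m n = 2 sₙ`. -/
abbrev Conf {N : ℕ} (m : Fin N → ℕ) : Type := (n : Fin N) → Fin (m n + 1)

/-- `End(H)`, as matrices in the natural basis. -/
abbrev Op {N : ℕ} (m : Fin N → ℕ) : Type := Matrix (Conf m) (Conf m) ℂ

/-- `S^z = diag(s, s - 1, …, -s)` for `2 s = q`. -/
def spinZ (q : ℕ) : Matrix (Fin (q + 1)) (Fin (q + 1)) ℂ :=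
  Matrix.diagonal fun i => (q : ℂ) / 2 - (i : ℕ)

/-- `S^+`: superdiagonal entries `x(j) = √(j (2 s + 1 - j))`, `j = 1, …, 2 s`. -/
def spinPlus (q : ℕ) : Matrix (Fin (q + 1)) (Fin (q + 1)) ℂ :=
  Matrix.of fun i j =>
    if (j : ℕ) = (i : ℕ) + 1 then
      ((Real.sqrt (((j : ℕ) : ℝ) * ((q : ℝ) + 1 - ((j : ℕ) : ℝ))) : ℝ) : ℂ)
    else 0

/-- `S^-` is the transpose of `S^+`. -/
def spinMinus (q : ℕ) : Matrix (Fin (q + 1)) (Fin (q + 1)) ℂ := (spinPlus q)ᵀ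

/-- The operator on `H` acting as `X` on the `n`-th tensor factor and as the identity elsewhere. -/
def siteOp {N : ℕ} (m : Fin N → ℕ) (n : Fin N)
    (X : Matrix (Fin (m n + 1)) (Fin (m n + 1)) ℂ) : Op m :=
  Matrix.of fun i j => if ∀ p, p ≠ n → i p = j p then X (i n) (j n) else 0

/-- The Lax operator `L_{0n}(lam)`, a `2 × 2` matrix (auxiliary space) of operators on `H`. -/
def lax {N : ℕ} (m : Fin N → ℕ) (η : ℂ) (n : Fin N) (lam : ℂ) :
    Matrix (Fin 2) (Fin 2) (Op m) :=
  !![siteOp m n (lam • 1 + η • ((1 / 2 : ℂ) • 1 + spinZ (m n))), siteOp m n (η • spinMinus (m n));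
     siteOp m n (η • spinPlus (m n)), siteOp m n (lam • 1 + η • ((1 / 2 : ℂ) • 1 - spinZ (m n)))]

/-- `X ⊗ 1`: a numerical `2 × 2` matrix acting on the auxiliary space only. -/
def aux {N : ℕ} (m : Fin N → ℕ) (X : Matrix (Fin 2) (Fin 2) ℂ) : Matrix (Fin 2) (Fin 2) (Op m) :=
  X.map fun c => c • (1 : Op m)

/-- The monodromy matrix `K_0 L_{0N}(lam - ξ_N) ⋯ L_{01}(lam - ξ_1)`. -/
def monodromy {N : ℕ} (m : Fin N → ℕ) (η : ℂ) (ξ : Fin N → ℂ) (K : Matrix (Fin 2) (Fin 2) ℂ)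
    (lam : ℂ) : Matrix (Fin 2) (Fin 2) (Op m) :=
  aux m K * (List.ofFn fun n : Fin N => lax m η n (lam - ξ n)).reverse.prod

/-- `A^{(K)}(lam)`. -/
def opA {N : ℕ} (m : Fin N → ℕ) (η : ℂ) (ξ : Fin N → ℂ) (K : Matrix (Fin 2) (Fin 2) ℂ)
    (lam : ℂ) : Op m := monodromy m η ξ K lam 0 0

/-- `B^{(K)}(lam)`. -/
def opB {N : ℕ} (m : Fin N → ℕ) (η : ℂ) (ξ : Fin N → ℂ) (K : Matrix (Fin 2) (Fin 2) ℂ)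
    (lam : ℂ) : Op m := monodromy m η ξ K lam 0 1

/-- `C^{(K)}(lam)`. -/
def opC {N : ℕ} (m : Fin N → ℕ) (η : ℂ) (ξ : Fin N → ℂ) (K : Matrix (Fin 2) (Fin 2) ℂ)
    (lam : ℂ) : Op m := monodromy m η ξ K lam 1 0

/-- `D^{(K)}(lam)`. -/
def opD {N : ℕ} (m : Fin N → ℕ) (η : ℂ) (ξ : Fin N → ℂ) (K : Matrix (Fin 2) (Fin 2) ℂ)
    (lam : ℂ) : Op m := monodromy m η ξ K lam 1 1

/-- `a(lam) = ∏ₙ (lam - ξₙ⁻ + sₙ η)`, with `ξₙ⁻ = ξₙ - η / 2`. -/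
def funA {N : ℕ} (m : Fin N → ℕ) (η : ℂ) (ξ : Fin N → ℂ) (lam : ℂ) : ℂ :=
  ∏ n, (lam - (ξ n - η / 2) + (m n : ℂ) / 2 * η)

/-- `d(lam) = ∏ₙ (lam - ξₙ⁻ - sₙ η)`. -/
def funD {N : ℕ} (m : Fin N → ℕ) (η : ℂ) (ξ : Fin N → ℂ) (lam : ℂ) : ℂ :=
  ∏ n, (lam - (ξ n - η / 2) - (m n : ℂ) / 2 * η)

/-- `ξₙ^{(k)} = ξₙ⁻ + (sₙ - k) η`. -/
def node {N : ℕ} (m : Fin N → ℕ) (η : ℂ) (ξ : Fin N → ℂ) (n : Fin N) (k : ℕ) : ℂ :=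
  (ξ n - η / 2) + ((m n : ℂ) / 2 - (k : ℂ)) * η

/-- The normalization `∏_{b < a} (ξ_a^{(0)} - ξ_b^{(0)})^{1/2}` (principal square roots). -/
def normalization {N : ℕ} (m : Fin N → ℕ) (η : ℂ) (ξ : Fin N → ℂ) : ℂ :=
  ∏ a : Fin N, ∏ b ∈ Finset.univ.filter (fun b : Fin N => b < a),
    (node m η ξ a 0 - node m η ξ b 0) ^ (1 / 2 : ℂ)

/-- The reference covector `⟨0| = ⨂ₙ (1, 0, …, 0)`. -/
def refCovector {N : ℕ} (m : Fin N → ℕ) : Conf m → ℂ :=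
  fun i => ∏ n, if i n = 0 then 1 else 0

/-- The operator `∏ₙ ∏_{k < hₙ} F(ξₙ^{(k)}) / (k₁ a(ξₙ^{(k)}))` attached to a family `F(lam)`,
the factors being multiplied from left to right in increasing order of `n`, then of `k`. -/
def ladder {N : ℕ} (m : Fin N → ℕ) (η : ℂ) (ξ : Fin N → ℂ) (k₁ : ℂ) (F : ℂ → Op m)
    (h : Conf m) : Op m :=
  (List.ofFn fun n : Fin N =>
    (List.ofFn fun k : Fin (h n : ℕ) =>
      (k₁ * funA m η ξ (node m η ξ n k))⁻¹ • F (node m η ξ n k)).prod).prod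

/-- The covector `⟨h|_Sk`. -/
def skCovector {N : ℕ} (m : Fin N → ℕ) (η : ℂ) (ξ : Fin N → ℂ) (K : Matrix (Fin 2) (Fin 2) ℂ)
    (k₁ : ℂ) (h : Conf m) : Conf m → ℂ :=
  (normalization m η ξ)⁻¹ • (refCovector m ᵥ* ladder m η ξ k₁ (opA m η ξ K) h)

/-- The eigenvalue `b ∏ₙ (lam - ξₙ^{(hₙ)})`. -/
def eigB {N : ℕ} (m : Fin N → ℕ) (η : ℂ) (ξ : Fin N → ℂ) (b : ℂ) (h : Conf m) (lam : ℂ) : ℂ :=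
  b * ∏ n, (lam - node m η ξ n (h n))

/-- The interpolation coefficient `∏_{b ≠ a} (lam - ξ_b^{(h_b)}) / (ξ_a^{(h_a)} - ξ_b^{(h_b)})`. -/
def interp {N : ℕ} (m : Fin N → ℕ) (η : ℂ) (ξ : Fin N → ℂ) (h : Conf m) (a : Fin N)
    (lam : ℂ) : ℂ :=
  ∏ b ∈ Finset.univ.erase a,
    (lam - node m η ξ b (h b)) / (node m η ξ a (h a) - node m η ξ b (h b))

/-- The member of the family `v` with label `(h_1, …, h_a + e, …, h_N)`,
by convention zero when `h_a + e` is not in `{0, …, 2 s_a}`. -/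
def shift {N : ℕ} {m : Fin N → ℕ} (v : Conf m → Conf m → ℂ) (h : Conf m) (a : Fin N) (e : ℤ) :
    Conf m → ℂ :=
  if H : 0 ≤ ((h a : ℕ) : ℤ) + e ∧ ((h a : ℕ) : ℤ) + e ≤ (m a : ℤ) then
    v (Function.update h a ⟨(((h a : ℕ) : ℤ) + e).toNat, by omega⟩)
  else 0

/-- The number of entries equal to `1` (spins down) of an element of `{0, 1}^q`. -/
def downs {q : ℕ} (f : Fin q → Fin 2) : ℕ := (Finset.univ.filter fun i => f i = 1).card

/-- The fused matrix `P⁺ W_1 ⋯ W_q P⁺` on the symmetric subspace of `(ℂ²)^{⊗ q}`, in the orthonormal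
basis `|j⟩ = binom(q, j)^{-1/2} ∑_{downs f = j} e_{f 1} ⊗ ⋯ ⊗ e_{f q}`, `j = 0, …, q`; this
basis identifies the symmetric subspace with the spin `q / 2` representation above. -/
def fused (q : ℕ) (W : Matrix (Fin 2) (Fin 2) ℂ) : Matrix (Fin (q + 1)) (Fin (q + 1)) ℂ :=
  Matrix.of fun j k =>
    (∑ f ∈ Finset.univ.filter (fun f : Fin q → Fin 2 => downs f = j),
      ∑ g ∈ Finset.univ.filter (fun g : Fin q → Fin 2 => downs g = k), ∏ i, W (f i) (g i)) /
      ((Real.sqrt ((q.choose j : ℝ) * (q.choose k : ℝ)) : ℝ) : ℂ)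

/-- The operator `⨂ₙ W_n^{(2 sₙ)}` on `H`. -/
def globalTwist {N : ℕ} (m : Fin N → ℕ) (W : Matrix (Fin 2) (Fin 2) ℂ) : Op m :=
  Matrix.of fun i j => ∏ n, fused (m n) W (i n) (j n)

/-- `tr_0 [W_0 E_0 W_0⁻¹ M_0^{(K)}(lam)]` for a numerical `2 × 2` matrix `E`. -/
def tildeOp {N : ℕ} (m : Fin N → ℕ) (η : ℂ) (ξ : Fin N → ℂ) (K W E : Matrix (Fin 2) (Fin 2) ℂ)
    (lam : ℂ) : Op m :=
  Matrix.trace (aux m (W * E * W⁻¹) * monodromy m η ξ K lam)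

/-- `Ã^{(K)}(lam)`. -/
def tildeA {N : ℕ} (m : Fin N → ℕ) (η : ℂ) (ξ : Fin N → ℂ) (K W : Matrix (Fin 2) (Fin 2) ℂ)
    (lam : ℂ) : Op m := tildeOp m η ξ K W !![1, 0; 0, 0] lam

/-- `B̃^{(K)}(lam)`. -/
def tildeB {N : ℕ} (m : Fin N → ℕ) (η : ℂ) (ξ : Fin N → ℂ) (K W : Matrix (Fin 2) (Fin 2) ℂ)
    (lam : ℂ) : Op m := tildeOp m η ξ K W !![0, 0; 1, 0] lam

/-- `D̃^{(K)}(lam)`. -/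
def tildeD {N : ℕ} (m : Fin N → ℕ) (η : ℂ) (ξ : Fin N → ℂ) (K W : Matrix (Fin 2) (Fin 2) ℂ)
    (lam : ℂ) : Op m := tildeOp m η ξ K W !![0, 0; 0, 1] lam

/-- The covector `⟨h|_Sk` for the twist `W⁻¹ K W`, transported by `(⨂ₙ W_n^{(2 sₙ)})⁻¹`. -/
def skCovectorTilde {N : ℕ} (m : Fin N → ℕ) (η : ℂ) (ξ : Fin N → ℂ)
    (K W : Matrix (Fin 2) (Fin 2) ℂ) (k₁ : ℂ) (h : Conf m) : Conf m → ℂ :=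
  skCovector m η ξ (W⁻¹ * K * W) k₁ h ᵥ* (globalTwist m W)⁻¹

end HigherSpin

end

noncomputable section

namespace HigherSpin

/-! ### Operators acting on a single site -/

section Site

variable {N : ℕ} (m : Fin N → ℕ)

/-! The monodromy matrix satisfies the rational exchange relations and has a central quantum
determinant. Both properties hold for one Lax operator and pass to products, since entries at
different sites commute (`Exchange.mul`, `HasQDet.mul`). The reference covector is a left
eigencovector of `opB` whose eigenvalue has the top nodes of the strings as roots.

Let `u` be a left eigencovector of `opB` with eigenvalue `b ∏ (x - z n)`. At `y = z r` the unwanted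
term of the A-B exchange relation contains `u B(z r) = 0`, so `u A(z r)` is again an eigencovector,
with `z r` replaced by `z r - η`; D moves the root by `+η` (`vecMul_opA_opB`, `vecMul_opD_opB`).
Hence every ladder covector is an eigencovector. The quantum determinant at a root shows that D
undoes A up to a nonzero scalar (`skCovector_incr_vecMul_opD`), so none of these covectors vanishes.
Their eigenvalues are distinct polynomials and their number is the dimension, which gives a basis.

Completeness then closes the ladder at its ends: a step off a string would yield an eigenvalue
outside the known spectrum, hence the zero covector (`eq_zero_of_vecMul_opB`). Since A and D are
polynomials of degree at most `N` with scalar coefficient of degree `N`, their action follows from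
the values at the `N` roots by Lagrange interpolation (`HasLead.vecMul_eq`). Off a finite set `opB`
is invertible, so the quantum determinant fixes C by continuity.

For `b = 0` one uses `GL₂` invariance: `W` on the auxiliary space tensored with its symmetric powers
at the sites commutes with each Lax operator (`fullTwist_commute_lax`). It therefore intertwines the
monodromies of `W⁻¹ K W` and `K`, and the first case is transported. -/

theorem sum_ite_agree (n : Fin N) (i : Conf m) (f : Conf m → ℂ) :
    (∑ k : Conf m, if ∀ p, p ≠ n → i p = k p then f k else 0) =
      ∑ x, f (Function.update i n x) := by
  rw [← Finset.sum_filter]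
  symm
  refine Finset.sum_bij (fun x _ => Function.update i n x) ?_ ?_ ?_ ?_
  · intro x _
    simp only [Finset.mem_filter, Finset.mem_univ, true_and]
    intro p hp
    rw [Function.update_of_ne hp]
  · intro x _ y _ hxy
    exact Function.update_injective i n hxy
  · intro k hk
    simp only [Finset.mem_filter, Finset.mem_univ, true_and] at hk
    refine ⟨k n, Finset.mem_univ _, ?_⟩
    funext p
    by_cases hp : p = n
    · subst hp; simp
    · rw [Function.update_of_ne hp, hk p hp]
  · intros; rfl

theorem siteOp_mul_apply (n : Fin N) (X : Matrix (Fin (m n + 1)) (Fin (m n + 1)) ℂ) (Y : Op m)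
    (i j : Conf m) :
    (siteOp m n X * Y) i j = ∑ x, X (i n) x * Y (Function.update i n x) j := by
  rw [Matrix.mul_apply]
  simp only [siteOp, Matrix.of_apply, ite_mul, zero_mul]
  rw [sum_ite_agree m n i fun k => X (i n) (k n) * Y k j]
  simp

theorem mul_siteOp_apply (n : Fin N) (X : Matrix (Fin (m n + 1)) (Fin (m n + 1)) ℂ) (Y : Op m)
    (i j : Conf m) :
    (Y * siteOp m n X) i j = ∑ x, Y i (Function.update j n x) * X x (j n) := by
  rw [Matrix.mul_apply]
  simp only [siteOp, Matrix.of_apply, mul_ite, mul_zero]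
  have h := sum_ite_agree m n j fun k => Y i k * X (k n) (j n)
  simp only [Function.update_self] at h
  rw [← h]
  refine Finset.sum_congr rfl fun k _ => ?_
  simp only [eq_comm]

theorem vecMul_siteOp (n : Fin N) (X : Matrix (Fin (m n + 1)) (Fin (m n + 1)) ℂ)
    (v : Conf m → ℂ) (j : Conf m) :
    (v ᵥ* siteOp m n X) j = ∑ x, v (Function.update j n x) * X x (j n) := by
  rw [Matrix.vecMul, dotProduct]
  simp only [siteOp, Matrix.of_apply, mul_ite, mul_zero]
  have h := sum_ite_agree m n j fun k => v k * X (k n) (j n)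
  simp only [Function.update_self] at h
  rw [← h]
  refine Finset.sum_congr rfl fun k _ => ?_
  simp only [eq_comm]

theorem siteOp_mul (n : Fin N) (X Y : Matrix (Fin (m n + 1)) (Fin (m n + 1)) ℂ) :
    siteOp m n (X * Y) = siteOp m n X * siteOp m n Y := by
  ext i j
  rw [siteOp_mul_apply]
  simp only [siteOp, Matrix.of_apply, Function.update_self, Matrix.mul_apply]
  have h : ∀ x, (∀ p, p ≠ n → Function.update i n x p = j p) ↔ ∀ p, p ≠ n → i p = j p := by
    intro x
    refine forall_congr' fun p => forall_congr' fun hp => ?_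
    rw [Function.update_of_ne hp]
  simp only [h]
  split_ifs <;> simp

theorem siteOp_add (n : Fin N) (X Y : Matrix (Fin (m n + 1)) (Fin (m n + 1)) ℂ) :
    siteOp m n (X + Y) = siteOp m n X + siteOp m n Y := by
  ext i j
  simp only [siteOp, Matrix.of_apply, Matrix.add_apply]
  split_ifs <;> simp

theorem siteOp_smul (n : Fin N) (c : ℂ) (X : Matrix (Fin (m n + 1)) (Fin (m n + 1)) ℂ) :
    siteOp m n (c • X) = c • siteOp m n X := by
  ext i j
  simp [siteOp]

theorem siteOp_sub (n : Fin N) (X Y : Matrix (Fin (m n + 1)) (Fin (m n + 1)) ℂ) :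
    siteOp m n (X - Y) = siteOp m n X - siteOp m n Y := by
  rw [sub_eq_add_neg, ← neg_one_smul ℂ Y, siteOp_add, siteOp_smul, neg_one_smul, ← sub_eq_add_neg]

theorem siteOp_one (n : Fin N) : siteOp m n 1 = 1 := by
  ext i j
  simp only [siteOp, Matrix.of_apply, Matrix.one_apply]
  by_cases h : i = j
  · subst h; simp
  · rw [if_neg h]
    split_ifs with h1 h2
    · exact absurd (funext fun p => by
        by_cases hp : p = n
        · subst hp; exact h2
        · exact h1 p hp) h
    · rfl
    · rfl

theorem siteOp_commute {n n' : Fin N} (hn : n ≠ n')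
    (X : Matrix (Fin (m n + 1)) (Fin (m n + 1)) ℂ)
    (Y : Matrix (Fin (m n' + 1)) (Fin (m n' + 1)) ℂ) :
    Commute (siteOp m n X) (siteOp m n' Y) := by
  ext i j
  rw [siteOp_mul_apply, mul_siteOp_apply]
  -- In either order only one intermediate state at site `n` contributes: its final value `j n`
  -- here, its initial value `i n` in `key'`.
  have key : ∀ x, siteOp m n' Y (Function.update i n x) j =
      if x = j n ∧ ∀ p, p ≠ n → p ≠ n' → i p = j p then Y (i n') (j n') else 0 := by
    intro x
    simp only [siteOp, Matrix.of_apply]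
    rw [Function.update_of_ne hn.symm]
    refine if_congr ⟨fun h => ⟨?_, fun p h1 h2 => ?_⟩, fun h p hp => ?_⟩ rfl rfl
    · simpa using h n hn
    · simpa [h1] using h p h2
    · by_cases h1 : p = n
      · subst h1; simpa using h.1
      · rw [Function.update_of_ne h1]; exact h.2 p h1 hp
  have key' : ∀ x, siteOp m n' Y i (Function.update j n x) =
      if x = i n ∧ ∀ p, p ≠ n → p ≠ n' → i p = j p then Y (i n') (j n') else 0 := by
    intro x
    simp only [siteOp, Matrix.of_apply]
    rw [Function.update_of_ne hn.symm]
    refine if_congr ⟨fun h => ⟨?_, fun p h1 h2 => ?_⟩, fun h p hp => ?_⟩ rfl rfl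
    · simpa using (h n hn).symm
    · simpa [h1] using h p h2
    · by_cases h1 : p = n
      · subst h1; simpa using h.1.symm
      · rw [Function.update_of_ne h1]; exact h.2 p h1 hp
  simp only [key, key']
  by_cases hp : ∀ p, p ≠ n → p ≠ n' → i p = j p
  · simp only [and_iff_left hp]
    simp [mul_comm]
  · simp only [hp, and_false, if_false, mul_zero, zero_mul]

end Site

/-! ### The spin algebra -/

section Spin

variable (q : ℕ)

theorem spinPlus_mul_apply (X : Matrix (Fin (q + 1)) (Fin (q + 1)) ℂ) (i j : Fin (q + 1)) :
    (spinPlus q * X) i j = if h : (i : ℕ) < q then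
      ((Real.sqrt ((((i : ℕ) : ℝ) + 1) * ((q : ℝ) - ((i : ℕ) : ℝ))) : ℝ) : ℂ) *
        X ⟨i + 1, by omega⟩ j else 0 := by
  rw [Matrix.mul_apply]
  split_ifs with h
  · rw [Finset.sum_eq_single ⟨(i : ℕ) + 1, by omega⟩]
    · simp only [spinPlus, Matrix.of_apply, if_true]
      congr 4 <;> push_cast <;> ring
    · intro k _ hk
      have : ¬ (k : ℕ) = i + 1 := fun h' => hk (Fin.ext h')
      simp [spinPlus, this]
    · simp
  · refine Finset.sum_eq_zero fun k _ => ?_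
    have : ¬ (k : ℕ) = i + 1 := by omega
    simp [spinPlus, this]

theorem sqrt_mul_self_cast {x : ℝ} (hx : 0 ≤ x) : ((Real.sqrt x : ℝ) : ℂ) * (Real.sqrt x : ℝ) = x := by
  rw [← Complex.ofReal_mul, Real.mul_self_sqrt hx]

/-- The Casimir identity with the square completed. In this form it makes the quantum determinant a
difference of squares, and its difference with the companion identity is the commutator of the
ladder operators. -/
theorem spinPlus_mul_spinMinus :
    spinPlus q * spinMinus q = ((q + 1 : ℂ) / 2) ^ 2 • 1 -
      ((1 / 2 : ℂ) • 1 - spinZ q) * ((1 / 2 : ℂ) • 1 - spinZ q) := by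
  ext i j
  have hdiag : ((1 / 2 : ℂ) • 1 - spinZ q) =
      Matrix.diagonal fun i : Fin (q + 1) => (1 / 2 : ℂ) - (q / 2 - (i : ℕ)) := by
    ext i j; by_cases h : i = j <;> simp [spinZ, h]
  rw [hdiag, Matrix.diagonal_mul_diagonal, spinPlus_mul_apply]
  have hi := i.isLt
  simp only [spinMinus, Matrix.transpose_apply, spinPlus, Matrix.of_apply, Matrix.sub_apply,
    Matrix.smul_apply, Matrix.one_apply, Matrix.diagonal_apply, smul_eq_mul]
  by_cases hij : i = j
  · subst hij
    simp only [if_true, mul_one]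
    by_cases h : (i : ℕ) < q
    · rw [dif_pos h]
      have e : ((((i : ℕ) + 1 : ℕ) : ℝ) * ((q : ℝ) + 1 - (((i : ℕ) + 1 : ℕ) : ℝ))) =
        ((((i : ℕ) : ℝ) + 1) * ((q : ℝ) - ((i : ℕ) : ℝ))) := by push_cast; ring
      rw [e, sqrt_mul_self_cast]
      · push_cast; ring
      · have : ((i : ℕ) : ℝ) ≤ q := by exact_mod_cast h.le
        exact mul_nonneg (by positivity) (by linarith)
    · rw [dif_neg h]
      have : (i : ℕ) = q := by omega
      rw [this]; ring
  · have h1 : ¬ (i : ℕ) = j := fun h => hij (Fin.ext h)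
    simp [hij, h1]

theorem spinMinus_mul_spinPlus :
    spinMinus q * spinPlus q = ((q + 1 : ℂ) / 2) ^ 2 • 1 -
      ((1 / 2 : ℂ) • 1 + spinZ q) * ((1 / 2 : ℂ) • 1 + spinZ q) := by
  ext i j
  have hdiag : ((1 / 2 : ℂ) • 1 + spinZ q) =
      Matrix.diagonal fun i : Fin (q + 1) => (1 / 2 : ℂ) + (q / 2 - (i : ℕ)) := by
    ext i j; by_cases h : i = j <;> simp [spinZ, h]
  rw [hdiag, Matrix.diagonal_mul_diagonal, Matrix.mul_apply]
  have hi := i.isLt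
  simp only [spinMinus, Matrix.transpose_apply, spinPlus, Matrix.of_apply, Matrix.sub_apply,
    Matrix.smul_apply, Matrix.one_apply, Matrix.diagonal_apply, smul_eq_mul]
  by_cases hij : i = j
  · subst hij
    simp only [if_true, mul_one]
    by_cases h0 : (i : ℕ) = 0
    · rw [Finset.sum_eq_zero]
      · rw [h0]; push_cast; ring
      · intro k _
        rw [if_neg (by omega), zero_mul]
    · rw [Finset.sum_eq_single ⟨(i : ℕ) - 1, by omega⟩]
      · have h1 : (i : ℕ) = (i : ℕ) - 1 + 1 := by omega
        simp only [← h1, if_true]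
        rw [sqrt_mul_self_cast]
        · push_cast; ring
        · have : ((i : ℕ) : ℝ) ≤ q := by exact_mod_cast (by omega : (i : ℕ) ≤ q)
          exact mul_nonneg (by positivity) (by linarith)
      · intro k _ hk
        rw [if_neg, zero_mul]
        intro h; exact hk (Fin.ext (by simp; omega))
      · simp
  · simp only [if_neg hij, mul_zero, sub_zero]
    refine Finset.sum_eq_zero fun k _ => ?_
    by_cases h1 : (i : ℕ) = k + 1
    · rw [if_neg (c := (j : ℕ) = k + 1), mul_zero]
      intro h; exact hij (Fin.ext (by omega))
    · rw [if_neg h1, zero_mul]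

theorem spinZ_mul_spinPlus : spinZ q * spinPlus q = spinPlus q * spinZ q + spinPlus q := by
  ext i j
  rw [spinZ, Matrix.add_apply, Matrix.diagonal_mul, Matrix.mul_diagonal]
  by_cases h : (j : ℕ) = i + 1
  · simp only [spinPlus, Matrix.of_apply, h]; push_cast; ring
  · simp [spinPlus, h]

theorem spinZ_mul_spinMinus : spinZ q * spinMinus q = spinMinus q * spinZ q - spinMinus q := by
  have h := congrArg Matrix.transpose (spinZ_mul_spinPlus q)
  have hz : (spinZ q)ᵀ = spinZ q := Matrix.diagonal_transpose _
  rw [Matrix.transpose_mul, Matrix.transpose_add, Matrix.transpose_mul, hz] at h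
  change spinMinus q * spinZ q = spinZ q * spinMinus q + spinMinus q at h
  rw [h]; abel

end Spin

/-! ### The Yangian exchange relations and the quantum determinant -/

section Yangian

variable {R : Type*} [Ring R]

/-- The matrix `σ^y Tᵗ σ^y`. -/
def adj (T : Matrix (Fin 2) (Fin 2) R) : Matrix (Fin 2) (Fin 2) R :=
  !![T 1 1, -T 0 1; -T 1 0, T 0 0]

/-- The entries of `T` need not commute among themselves; the reversal of the product uses only that
they commute with those of `S`. -/
theorem adj_mul {T S : Matrix (Fin 2) (Fin 2) R} (h : ∀ i j k l, Commute (T i j) (S k l)) :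
    adj (T * S) = adj S * adj T := by
  ext i j
  fin_cases i <;> fin_cases j <;>
    simp [adj, Matrix.mul_apply, Fin.sum_univ_two, (h _ _ _ _).eq, add_comm]

variable [Algebra ℂ R]

/-- The exchange relations `R(x - y) T₁(x) T₂(y) = T₂(y) T₁(x) R(x - y)` of the rational
`6`-vertex `R`-matrix, written in components. -/
def Exchange (η : ℂ) (T : ℂ → Matrix (Fin 2) (Fin 2) R) : Prop :=
  ∀ x y i j k l,
    (x - y) • (T x i j * T y k l) + η • (T x k j * T y i l) =
      (x - y) • (T y k l * T x i j) + η • (T y k j * T x i l)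

/-- The entries of `S x` move past those of `T y`, so the relation for `T` applies to the left pair
and the one for `S` to the right pair. The two leftover `η` terms agree after exchanging the
summation indices. -/
theorem Exchange.mul {η : ℂ} {T S : ℂ → Matrix (Fin 2) (Fin 2) R} (hT : Exchange η T)
    (hS : Exchange η S) (hTS : ∀ x y i j k l, Commute (T x i j) (S y k l)) :
    Exchange η fun x => T x * S x := by
  intro x y i j k l
  have e : ∀ x y i j k l, (T x * S x) i j * (T y * S y) k l =
      ∑ p, ∑ r, (T x i p * T y k r) * (S x p j * S y r l) := by
    intro x y i j k l
    rw [Matrix.mul_apply, Matrix.mul_apply, Finset.sum_mul_sum]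
    refine Finset.sum_congr rfl fun p _ => Finset.sum_congr rfl fun r _ => ?_
    rw [mul_assoc, ← mul_assoc (S x p j), ← (hTS y x k r p j).eq]
    simp only [mul_assoc]
  simp only [e]
  have h1 : (x - y) • (∑ p, ∑ r, (T x i p * T y k r) * (S x p j * S y r l)) +
      η • (∑ p, ∑ r, (T x k p * T y i r) * (S x p j * S y r l)) =
      ∑ p, ∑ r, ((x - y) • (T y k r * T x i p) + η • (T y k p * T x i r)) *
        (S x p j * S y r l) := by
    simp only [← hT x y, add_mul, smul_mul_assoc, Finset.sum_add_distrib, Finset.smul_sum]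
  have h2 : (x - y) • (∑ p, ∑ r, (T y k p * T x i r) * (S y p l * S x r j)) +
      η • (∑ p, ∑ r, (T y k p * T x i r) * (S y p j * S x r l)) =
      ∑ p, ∑ r, (T y k r * T x i p) * ((x - y) • (S x p j * S y r l) +
        η • (S x r j * S y p l)) := by
    simp only [hS x y, mul_add, mul_smul_comm, Finset.sum_add_distrib, Finset.smul_sum]
    congr 1
    · rw [Finset.sum_comm]
    · rw [Finset.sum_comm]
  rw [h1, h2]
  simp only [mul_add, add_mul, mul_smul_comm, smul_mul_assoc, Finset.sum_add_distrib]
  congr 1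
  rw [Finset.sum_comm]

theorem Exchange.const (η : ℂ) (K : Matrix (Fin 2) (Fin 2) ℂ) :
    Exchange η fun _ => K.map fun c => c • (1 : R) := by
  intro x y i j k l
  simp only [Matrix.map_apply, smul_mul_smul_comm, mul_one, mul_comm]

/-- The two sides differ by `(x - y) η²` times the difference between the commutator of two
generators and its `gl₂` value; scalar and cubic terms cancel. -/
theorem Exchange.linear (η c : ℂ) (G : Matrix (Fin 2) (Fin 2) R)
    (hG : ∀ i j k l, G i j * G k l = G k l * G i j +
      (1 : Matrix (Fin 2) (Fin 2) ℂ) i l • G k j - (1 : Matrix (Fin 2) (Fin 2) ℂ) k j • G i l) :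
    Exchange η fun x => Matrix.of fun i j =>
      ((x + c) * (1 : Matrix (Fin 2) (Fin 2) ℂ) i j) • (1 : R) + η • G i j := by
  intro x y i j k l
  simp only [Matrix.of_apply, mul_add, add_mul, smul_mul_smul_comm, mul_one, one_mul, hG i j k l]
  module

/-- `T` has the central quantum determinant `f`. -/
def HasQDet (η : ℂ) (T : ℂ → Matrix (Fin 2) (Fin 2) R) (f : ℂ → ℂ) : Prop :=
  ∀ x, T x * adj (T (x - η)) = f x • 1

theorem HasQDet.mul {η : ℂ} {T S : ℂ → Matrix (Fin 2) (Fin 2) R} {f g : ℂ → ℂ}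
    (hT : HasQDet η T f) (hS : HasQDet η S g)
    (hTS : ∀ x y i j k l, Commute (T x i j) (S y k l)) :
    HasQDet η (fun x => T x * S x) (f * g) := by
  intro x
  rw [adj_mul (hTS _ _), mul_assoc, ← mul_assoc (S x), hS x, smul_mul_assoc, one_mul,
    mul_smul_comm, hT x, smul_smul, Pi.mul_apply, mul_comm]

theorem HasQDet.const (η : ℂ) (K : Matrix (Fin 2) (Fin 2) ℂ) :
    HasQDet η (fun _ => K.map fun c => c • (1 : R)) fun _ => K.det := by
  intro x
  ext i j
  fin_cases i <;> fin_cases j <;>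
    simp [adj, Matrix.mul_apply, Fin.sum_univ_two, Matrix.det_fin_two, smul_smul,
      ← sub_eq_add_neg, ← neg_smul, ← add_smul] <;> ring_nf <;> simp

end Yangian

/-! ### Lax operators and the monodromy matrix -/

section Monodromy

variable {N : ℕ} (m : Fin N → ℕ) (η : ℂ)

theorem lax_commute {n n' : Fin N} (h : n ≠ n') (x y : ℂ) (i j k l : Fin 2) :
    Commute (lax m η n x i j) (lax m η n' y k l) := by
  fin_cases i <;> fin_cases j <;> fin_cases k <;> fin_cases l <;> exact siteOp_commute m h _ _

/-- The `gl₂` generators at the site `n`. -/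
def gen (n : Fin N) : Matrix (Fin 2) (Fin 2) (Op m) :=
  !![siteOp m n (spinZ (m n)), siteOp m n (spinMinus (m n));
     siteOp m n (spinPlus (m n)), -siteOp m n (spinZ (m n))]

theorem lax_eq (n : Fin N) (x : ℂ) :
    lax m η n x = Matrix.of fun i j =>
      ((x + η / 2) * (1 : Matrix (Fin 2) (Fin 2) ℂ) i j) • (1 : Op m) + η • gen m n i j := by
  ext1 i j
  fin_cases i <;> fin_cases j <;>
    simp [lax, gen, siteOp_add, siteOp_sub, siteOp_smul, siteOp_one] <;> module

theorem gen_commutator (n : Fin N) (i j k l : Fin 2) :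
    gen m n i j * gen m n k l = gen m n k l * gen m n i j +
      (1 : Matrix (Fin 2) (Fin 2) ℂ) i l • gen m n k j -
      (1 : Matrix (Fin 2) (Fin 2) ℂ) k j • gen m n i l := by
  have hp := congrArg (siteOp m n) (spinZ_mul_spinPlus (m n))
  have hm := congrArg (siteOp m n) (spinZ_mul_spinMinus (m n))
  -- Subtracting the two Casimir identities gives `[S⁺, S⁻] = 2 S^z`.
  have hpm : siteOp m n (spinPlus (m n)) * siteOp m n (spinMinus (m n)) =
      siteOp m n (spinMinus (m n)) * siteOp m n (spinPlus (m n)) +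
        (2 : ℂ) • siteOp m n (spinZ (m n)) := by
    rw [← siteOp_mul, ← siteOp_mul, ← siteOp_smul, ← siteOp_add, spinPlus_mul_spinMinus,
      spinMinus_mul_spinPlus]
    congr 1
    simp only [sub_mul, mul_sub, add_mul, mul_add, mul_one, smul_mul_assoc,
      mul_smul_comm, one_mul]
    module
  rw [siteOp_add, siteOp_mul, siteOp_mul] at hp
  rw [siteOp_sub, siteOp_mul, siteOp_mul] at hm
  fin_cases i <;> fin_cases j <;> fin_cases k <;> fin_cases l <;>
    simp [gen, hp, hm, hpm] <;> module

theorem lax_exchange (n : Fin N) (c : ℂ) : Exchange η fun x => lax m η n (x - c) := by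
  have h := Exchange.linear η (η / 2 - c) (gen m n) (gen_commutator m n)
  convert h using 2 with x
  rw [lax_eq]
  simp only [show x - c + η / 2 = x + (η / 2 - c) by ring]

/-- With `u = x - ξ n` the diagonal entries are `u² - η² (1/2 ± S^z)² - η² S^∓ S^±`. The Casimir
identity turns them into `u² - (η (m n + 1) / 2)²`, which factors as claimed. -/
theorem lax_hasQDet (ξ : Fin N → ℂ) (n : Fin N) : HasQDet η (fun x => lax m η n (x - ξ n)) fun x =>
    (x - (ξ n - η / 2) + (m n : ℂ) / 2 * η) * (x - η - (ξ n - η / 2) - (m n : ℂ) / 2 * η) := by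
  intro x
  have hpm := congrArg (siteOp m n) (spinPlus_mul_spinMinus (m n))
  have hmp := congrArg (siteOp m n) (spinMinus_mul_spinPlus (m n))
  have hp := congrArg (siteOp m n) (spinZ_mul_spinPlus (m n))
  have hm := congrArg (siteOp m n) (spinZ_mul_spinMinus (m n))
  simp only [siteOp_add, siteOp_sub, siteOp_smul, siteOp_mul, siteOp_one] at hpm hmp hp hm
  simp only [lax_eq]
  ext1 i j
  fin_cases i <;> fin_cases j <;>
    simp [adj, gen, Matrix.mul_apply, Fin.sum_univ_two, hpm, hmp, hp, hm, mul_add, add_mul,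
      mul_sub, sub_mul, smul_smul, smul_add, smul_sub] <;> module

/-- The product of the Lax operators of the sites in a list. -/
def laxProd (ξ : Fin N → ℂ) (l : List (Fin N)) (x : ℂ) : Matrix (Fin 2) (Fin 2) (Op m) :=
  (l.map fun n => lax m η n (x - ξ n)).prod

theorem monodromy_eq (ξ : Fin N → ℂ) (K : Matrix (Fin 2) (Fin 2) ℂ) (x : ℂ) :
    monodromy m η ξ K x = aux m K * laxProd m η ξ (List.finRange N).reverse x := by
  rw [monodromy, laxProd, List.map_reverse, ← List.ofFn_eq_map]

theorem nodup_reverse_finRange (N : ℕ) : (List.finRange N).reverse.Nodup :=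
  List.nodup_reverse.2 (List.nodup_finRange N)

variable {m η} (ξ : Fin N → ℂ)

theorem laxProd_cons (n : Fin N) (l : List (Fin N)) (x : ℂ) :
    laxProd m η ξ (n :: l) x = lax m η n (x - ξ n) * laxProd m η ξ l x := by
  simp [laxProd]

theorem commute_laxProd {n : Fin N} {l : List (Fin N)} (hn : n ∉ l) (x y : ℂ) (i j k r : Fin 2) :
    Commute (lax m η n x i j) (laxProd m η ξ l y k r) := by
  induction l generalizing k r with
  | nil =>
    simp only [laxProd, List.map_nil, List.prod_nil, Matrix.one_apply]
    split_ifs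
    · exact Commute.one_right _
    · exact Commute.zero_right _
  | cons p l ih =>
    rw [List.mem_cons, not_or] at hn
    rw [laxProd_cons, Matrix.mul_apply]
    exact Commute.sum_right _ _ _ fun s _ =>
      (lax_commute m η hn.1 _ _ _ _ _ _).mul_right (ih hn.2 _ _)

theorem aux_commute (K : Matrix (Fin 2) (Fin 2) ℂ) (i j : Fin 2) (X : Op m) :
    Commute (aux m K i j) X := by
  simpa [aux] using (Commute.one_left X).smul_left (K i j)

theorem laxProd_exchange {l : List (Fin N)} (hl : l.Nodup) : Exchange η (laxProd m η ξ l) := by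
  induction l with
  | nil =>
    have h := Exchange.const (R := Op m) η 1
    convert h using 2
    ext1 i j
    simp [laxProd, Matrix.one_apply]
  | cons n l ih =>
    rw [List.nodup_cons] at hl
    convert (lax_exchange m η n (ξ n)).mul (ih hl.2)
      fun x y i j k r => commute_laxProd ξ hl.1 _ _ _ _ _ _ using 2
    exact laxProd_cons ξ n l _

theorem laxProd_hasQDet {l : List (Fin N)} (hl : l.Nodup) : HasQDet η (laxProd m η ξ l) fun x =>
    (l.map fun n => (x - (ξ n - η / 2) + (m n : ℂ) / 2 * η) *
      (x - η - (ξ n - η / 2) - (m n : ℂ) / 2 * η)).prod := by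
  induction l with
  | nil =>
    have h := HasQDet.const (R := Op m) η 1
    convert h using 2
    · ext1 i j
      simp [laxProd, Matrix.one_apply]
    · simp
  | cons n l ih =>
    rw [List.nodup_cons] at hl
    convert (lax_hasQDet m η ξ n).mul (ih hl.2)
      fun x y i j k r => commute_laxProd ξ hl.1 _ _ _ _ _ _ using 2
    · exact laxProd_cons ξ n l _
    · simp

theorem prod_map_reverse_finRange {M : Type*} [CommMonoid M] (f : Fin N → M) :
    ((List.finRange N).reverse.map f).prod = ∏ n, f n := by
  rw [List.map_reverse, List.prod_reverse, ← List.ofFn_eq_map, List.prod_ofFn]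

theorem monodromy_exchange (K : Matrix (Fin 2) (Fin 2) ℂ) : Exchange η (monodromy m η ξ K) := by
  convert (Exchange.const (R := Op m) η K).mul (laxProd_exchange ξ (nodup_reverse_finRange N))
    fun x y i j k r => aux_commute K i j _ using 2
  exact monodromy_eq m η ξ K _

theorem monodromy_hasQDet (K : Matrix (Fin 2) (Fin 2) ℂ) : HasQDet η (monodromy m η ξ K) fun x =>
    K.det * (funA m η ξ x * funD m η ξ (x - η)) := by
  convert (HasQDet.const (R := Op m) η K).mul (laxProd_hasQDet ξ (nodup_reverse_finRange N))
    fun x y i j k r => aux_commute K i j _ using 2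
  · exact monodromy_eq m η ξ K _
  · rw [Pi.mul_apply, prod_map_reverse_finRange, Finset.prod_mul_distrib, funA, funD]

/-! ### The reference covector -/

theorem refCovector_vecMul_lax_zero_one (n : Fin N) (x : ℂ) :
    refCovector m ᵥ* lax m η n x 0 1 = 0 := by
  change refCovector m ᵥ* siteOp m n (η • spinMinus (m n)) = 0
  funext j
  rw [vecMul_siteOp, Pi.zero_apply]
  refine Finset.sum_eq_zero fun y _ => ?_
  by_cases hy : y = 0
  · subst hy
    simp [spinMinus, spinPlus]
  · have : refCovector m (Function.update j n y) = 0 :=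
      Finset.prod_eq_zero (Finset.mem_univ n) (by simp [hy])
    rw [this, zero_mul]

theorem refCovector_vecMul_lax_one_one (n : Fin N) (x : ℂ) :
    refCovector m ᵥ* lax m η n x 1 1 = (x + η / 2 - m n / 2 * η) • refCovector m := by
  change refCovector m ᵥ* siteOp m n (x • 1 + η • ((1 / 2 : ℂ) • 1 - spinZ (m n))) = _
  funext j
  rw [vecMul_siteOp, Finset.sum_eq_single (j n)]
  · rw [Function.update_eq_self, Pi.smul_apply, smul_eq_mul, mul_comm]
    by_cases hj : j n = 0
    · simp only [spinZ, Matrix.add_apply, Matrix.smul_apply, Matrix.sub_apply, Matrix.one_apply_eq,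
        Matrix.diagonal_apply_eq, hj, smul_eq_mul, Fin.val_zero]
      push_cast; ring
    · have : refCovector m j = 0 := Finset.prod_eq_zero (Finset.mem_univ n) (by simp [hj])
      rw [this, mul_zero, mul_zero]
  · intro y _ hy
    simp [spinZ, hy]
  · simp

theorem refCovector_vecMul_laxProd {l : List (Fin N)} (hl : l.Nodup) (x : ℂ) :
    refCovector m ᵥ* laxProd m η ξ l x 0 1 = 0 ∧
    refCovector m ᵥ* laxProd m η ξ l x 1 1 =
      (l.map fun n => x - (ξ n - η / 2) - (m n : ℂ) / 2 * η).prod • refCovector m := by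
  induction l with
  | nil => simp [laxProd]
  | cons n l ih =>
    rw [List.nodup_cons] at hl
    obtain ⟨h1, h2⟩ := ih hl.2
    rw [laxProd_cons]
    simp only [Matrix.mul_apply, Fin.sum_univ_two, Matrix.vecMul_add]
    -- Commutation lets the upper right entry of the remaining sites act on the reference covector
    -- first, where it gives zero.
    rw [(commute_laxProd ξ hl.1 _ x 0 0 0 1).eq, (commute_laxProd ξ hl.1 _ x 1 0 0 1).eq]
    simp only [← Matrix.vecMul_vecMul, h1, refCovector_vecMul_lax_zero_one,
      refCovector_vecMul_lax_one_one, Matrix.zero_vecMul, add_zero, zero_add, Matrix.smul_vecMul,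
      h2, List.map_cons, List.prod_cons, smul_smul, true_and]
    congr 2
    ring

/-- The twist mixes only rows, so `opB` combines the two right-column entries of the untwisted
monodromy. The upper one annihilates the reference covector and the lower one acts by `funD`. -/
theorem refCovector_vecMul_opB (K : Matrix (Fin 2) (Fin 2) ℂ) (x : ℂ) :
    refCovector m ᵥ* opB m η ξ K x = (K 0 1 * funD m η ξ x) • refCovector m := by
  obtain ⟨h1, h2⟩ := refCovector_vecMul_laxProd (m := m) (η := η) ξ (nodup_reverse_finRange N) x
  rw [opB, monodromy_eq, Matrix.mul_apply, Fin.sum_univ_two]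
  simp only [aux, Matrix.map_apply, smul_mul_assoc, one_mul, Matrix.vecMul_add, Matrix.vecMul_smul,
    h1, h2, smul_zero, zero_add, smul_smul, prod_map_reverse_finRange, funD]

end Monodromy

/-! ### Matrices with polynomial entries and Lagrange interpolation -/

section Polynomial

open Polynomial

variable {ι : Type*}

/-- The entries of `F` are polynomials of degree at most `d`, with coefficients of degree `d`
given by `L`. -/
def HasLead (d : ℕ) (F : ℂ → Matrix ι ι ℂ) (L : Matrix ι ι ℂ) : Prop :=
  ∃ P : Matrix ι ι ℂ[X], (∀ i j, (P i j).natDegree ≤ d ∧ (P i j).coeff d = L i j) ∧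
    ∀ x i j, F x i j = (P i j).eval x

theorem HasLead.const (L : Matrix ι ι ℂ) : HasLead 0 (fun _ => L) L :=
  ⟨L.map C, fun i j => by simp, fun x i j => by simp⟩

theorem HasLead.affine (X Y : Matrix ι ι ℂ) : HasLead 1 (fun x => x • X + Y) X := by
  refine ⟨Matrix.of fun i j => C (X i j) * Polynomial.X + C (Y i j), fun i j => ?_, fun x i j => ?_⟩
  · rw [Matrix.of_apply]
    exact ⟨natDegree_linear_le, by rw [coeff_add, coeff_C_mul, coeff_X_one, mul_one,
      coeff_C_succ, add_zero]⟩
  · simp only [Matrix.add_apply, Matrix.smul_apply, Matrix.of_apply, smul_eq_mul, eval_add,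
        eval_mul, eval_C, eval_X, mul_comm]

theorem HasLead.add {d : ℕ} {F G : ℂ → Matrix ι ι ℂ} {L M : Matrix ι ι ℂ} (hF : HasLead d F L)
    (hG : HasLead d G M) : HasLead d (fun x => F x + G x) (L + M) := by
  obtain ⟨P, hP, hP'⟩ := hF
  obtain ⟨Q, hQ, hQ'⟩ := hG
  exact ⟨P + Q, fun i j => ⟨natDegree_add_le_of_degree_le (hP i j).1 (hQ i j).1,
    by simp [(hP i j).2, (hQ i j).2]⟩, fun x i j => by simp [hP', hQ']⟩

theorem HasLead.mul [Fintype ι] {d e : ℕ} {F G : ℂ → Matrix ι ι ℂ} {L M : Matrix ι ι ℂ} (hF : HasLead d F L)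
    (hG : HasLead e G M) : HasLead (d + e) (fun x => F x * G x) (L * M) := by
  obtain ⟨P, hP, hP'⟩ := hF
  obtain ⟨Q, hQ, hQ'⟩ := hG
  refine ⟨P * Q, fun i j => ⟨?_, ?_⟩, fun x i j => ?_⟩
  · rw [Matrix.mul_apply]
    exact natDegree_sum_le_of_forall_le _ _ fun k _ =>
      natDegree_mul_le.trans (add_le_add (hP i k).1 (hQ k j).1)
  · rw [Matrix.mul_apply, Matrix.mul_apply, finsetSum_coeff]
    refine Finset.sum_congr rfl fun k _ => ?_
    rw [coeff_mul_add_eq_of_natDegree_le (hP i k).1 (hQ k j).1, (hP i k).2, (hQ k j).2]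
  · simp [Matrix.mul_apply, eval_finsetSum, hP', hQ']

theorem HasLead.continuous {d : ℕ} {F : ℂ → Matrix ι ι ℂ} {L : Matrix ι ι ℂ}
    (hF : HasLead d F L) : Continuous F := by
  obtain ⟨P, -, hP⟩ := hF
  refine continuous_matrix fun i j => ?_
  simp only [hP]
  exact (P i j).continuous

/-- Subtracting `a` times the nodal polynomial lowers the degree below `N` without changing the
values at the nodes, so Lagrange interpolation at the `N` nodes recovers the difference. -/
theorem HasLead.vecMul_eq [Fintype ι] [DecidableEq ι] {N : ℕ} {F : ℂ → Matrix ι ι ℂ} {a : ℂ} (hF : HasLead N F (a • 1))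
    (z : Fin N → ℂ) (hz : Function.Injective z) (u : ι → ℂ) (x : ℂ) :
    u ᵥ* F x = (a * ∏ n, (x - z n)) • u +
      ∑ r, (∏ q ∈ Finset.univ.erase r, (x - z q) / (z r - z q)) • (u ᵥ* F (z r)) := by
  obtain ⟨P, hP, hP'⟩ := hF
  funext j
  set p : ℂ[X] := ∑ i, C (u i) * P i j with hp
  have hpe : ∀ x, (u ᵥ* F x) j = p.eval x := by
    intro x
    simp [hp, Matrix.vecMul, dotProduct, eval_finsetSum, hP']
  have hpN : p.natDegree ≤ N := natDegree_sum_le_of_forall_le _ _ fun i _ =>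
    (natDegree_C_mul_le _ _).trans (hP i j).1
  have hpc : p.coeff N = a * u j := by
    simp [hp, (hP _ j).2, Matrix.one_apply, mul_comm]
  have hmon : (Lagrange.nodal Finset.univ z).natDegree = N := by
    simp [Lagrange.natDegree_nodal]
  have hcoef : (Lagrange.nodal Finset.univ z).coeff N = 1 := by
    have h := Lagrange.nodal_monic (s := Finset.univ) (v := z)
    rw [Monic, leadingCoeff, hmon] at h
    exact h
  have hdeg : (p - C (a * u j) * Lagrange.nodal Finset.univ z).degree <
      (Finset.univ : Finset (Fin N)).card := by
    rw [Finset.card_univ, Fintype.card_fin, degree_lt_iff_coeff_zero]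
    intro k hk
    rcases hk.eq_or_lt with rfl | hk
    · rw [coeff_sub, coeff_C_mul, hpc, hcoef, mul_one, sub_self]
    · rw [coeff_sub, coeff_C_mul, coeff_eq_zero_of_natDegree_lt (hpN.trans_lt hk),
        coeff_eq_zero_of_natDegree_lt (hmon.trans_lt hk), mul_zero, sub_zero]
  have h := congrArg (eval x) (Lagrange.eq_interpolate (hz.injOn) hdeg)
  rw [Lagrange.interpolate_apply, eval_finsetSum, eval_sub, eval_mul, eval_C, Lagrange.eval_nodal,
    sub_eq_iff_eq_add'] at h
  rw [hpe, h]
  simp only [Pi.add_apply, Pi.smul_apply, smul_eq_mul, Finset.sum_apply, hpe, eval_mul, eval_C,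
    eval_sub, Lagrange.eval_nodal_at_node (Finset.mem_univ _), mul_zero, sub_zero]
  congr 1
  · ring
  · refine Finset.sum_congr rfl fun r _ => ?_
    rw [mul_comm, Lagrange.basis, eval_prod]
    congr 1
    refine Finset.prod_congr rfl fun q _ => ?_
    simp [Lagrange.basisDivisor, div_eq_inv_mul]

theorem eq_of_eq_off_finite {E : Type*} [TopologicalSpace E] [T2Space E] {f g : ℂ → E}
    (hf : Continuous f) (hg : Continuous g) {s : Set ℂ} (hs : s.Finite)
    (h : ∀ x, x ∉ s → f x = g x) : f = g :=
  Continuous.ext_on (hs.countable.dense_compl ℝ) hf hg fun x hx => h x hx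

/-- The product of all pairwise differences is a nonzero polynomial, hence nonzero somewhere. This
reduces a commuting family of operators to a single one with simple spectrum. -/
theorem exists_eval_injective {κ : Type*} [Fintype κ] [DecidableEq κ] {p : κ → ℂ[X]}
    (hp : Function.Injective p) : ∃ x, Function.Injective fun i => (p i).eval x := by
  have h0 : ∏ ij ∈ (Finset.univ : Finset κ).offDiag, (p ij.1 - p ij.2) ≠ 0 := by
    refine Finset.prod_ne_zero_iff.2 fun ij hij => sub_ne_zero.2 fun h => ?_
    exact (Finset.mem_offDiag.1 hij).2.2 (hp h)
  obtain ⟨x, hx⟩ : ∃ x, (∏ ij ∈ (Finset.univ : Finset κ).offDiag, (p ij.1 - p ij.2)).eval x ≠ 0 := by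
    by_contra! h
    exact h0 (Polynomial.funext fun x => by simpa using h x)
  refine ⟨x, fun i j hij => ?_⟩
  by_contra hne
  rw [eval_prod] at hx
  refine hx (Finset.prod_eq_zero (i := (i, j)) (by simp [hne]) ?_)
  simpa [sub_eq_zero] using hij

end Polynomial

section Lead

variable {N : ℕ} {m : Fin N → ℕ} {η : ℂ} (ξ : Fin N → ℂ)

theorem lax_hasLead (n : Fin N) (c : ℂ) (i j : Fin 2) :
    HasLead 1 (fun x => lax m η n (x - c) i j)
      ((1 : Matrix (Fin 2) (Fin 2) ℂ) i j • (1 : Op m)) := by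
  convert HasLead.affine ((1 : Matrix (Fin 2) (Fin 2) ℂ) i j • (1 : Op m))
    (((η / 2 - c) * (1 : Matrix (Fin 2) (Fin 2) ℂ) i j) • 1 + η • gen m n i j) using 2
  rw [lax_eq, Matrix.of_apply]
  module

/-- The spin operators enter only the constant term of a Lax operator, so the top coefficient of a
product is the identity. -/
theorem laxProd_hasLead (l : List (Fin N)) (i j : Fin 2) :
    HasLead l.length (fun x => laxProd m η ξ l x i j)
      ((1 : Matrix (Fin 2) (Fin 2) ℂ) i j • (1 : Op m)) := by
  induction l generalizing i j with
  | nil =>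
    have h : ∀ x, laxProd m η ξ [] x i j = (1 : Matrix (Fin 2) (Fin 2) ℂ) i j • (1 : Op m) := by
      intro x
      rw [laxProd, List.map_nil, List.prod_nil, Matrix.one_apply, Matrix.one_apply]
      split_ifs <;> simp
    simpa only [h, List.length_nil] using
      HasLead.const ((1 : Matrix (Fin 2) (Fin 2) ℂ) i j • (1 : Op m))
  | cons n l ih =>
    convert ((lax_hasLead (η := η) n (ξ n) i 0).mul (ih 0 j)).add
      ((lax_hasLead (η := η) n (ξ n) i 1).mul (ih 1 j))
      using 1
    · rw [List.length_cons, add_comm]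
    · simp only [laxProd_cons, Matrix.mul_apply, Fin.sum_univ_two]
    · rw [smul_mul_smul_comm, smul_mul_smul_comm, ← add_smul, mul_one, ← Fin.sum_univ_two
        (f := fun k => (1 : Matrix (Fin 2) (Fin 2) ℂ) i k * (1 : Matrix (Fin 2) (Fin 2) ℂ) k j),
        ← Matrix.mul_apply, mul_one]

theorem monodromy_hasLead (K : Matrix (Fin 2) (Fin 2) ℂ) (i j : Fin 2) :
    HasLead N (fun x => monodromy m η ξ K x i j) (K i j • (1 : Op m)) := by
  convert ((HasLead.const (K i 0 • (1 : Op m))).mul (laxProd_hasLead (m := m) (η := η) ξ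
    (List.finRange N).reverse 0 j)).add ((HasLead.const (K i 1 • (1 : Op m))).mul
      (laxProd_hasLead (m := m) (η := η) ξ (List.finRange N).reverse 1 j)) using 1
  · simp
  · simp [monodromy_eq, aux, Matrix.mul_apply, Fin.sum_univ_two]
  · rw [smul_mul_smul_comm, smul_mul_smul_comm, ← add_smul, mul_one, ← Fin.sum_univ_two
      (f := fun k => K i k * (1 : Matrix (Fin 2) (Fin 2) ℂ) k j), ← Matrix.mul_apply, mul_one]

end Lead

/-! ### Ordered products of commuting factors -/

section Ladder

/-- Lengthening one block of an ordered product of commuting factors amounts to appending the new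
factor at the far right. -/
theorem prod_ofFn_mul_of_commute {M : Type*} [Monoid M] {N : ℕ} {f g : Fin N → M} (r : Fin N)
    (x : M) (hr : g r = f r * x) (hn : ∀ n, n ≠ r → g n = f n) (hx : ∀ n, Commute x (f n)) :
    (List.ofFn g).prod = (List.ofFn f).prod * x := by
  induction N with
  | zero => exact r.elim0
  | succ N ih =>
    rw [List.ofFn_succ, List.ofFn_succ, List.prod_cons, List.prod_cons]
    cases r using Fin.cases with
    | zero =>
      have h : (fun i : Fin N => g i.succ) = fun i => f i.succ :=
        funext fun i => hn _ (Fin.succ_ne_zero i)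
      have hc : Commute x (List.ofFn fun i : Fin N => f i.succ).prod :=
        Commute.list_prod_right _ _ fun y hy => by
          obtain ⟨i, rfl⟩ := (List.mem_ofFn' _ _).1 hy
          exact hx _
      rw [hr, h, mul_assoc, hc.eq, mul_assoc]
    | succ r =>
      rw [hn 0 (Fin.succ_ne_zero r).symm, mul_assoc, ih r hr
        (fun n h => hn _ fun h' => h (Fin.succ_injective _ h')) fun n => hx _]

variable {N : ℕ} {m : Fin N → ℕ} {η : ℂ} {ξ : Fin N → ℂ}

/-- The label `h` with `h_r` increased by one. -/
def incr (h : Conf m) (r : Fin N) (hr : (h r : ℕ) < m r) : Conf m :=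
  Function.update h r ⟨h r + 1, by omega⟩

theorem conf_induction {P : Conf m → Prop} (h0 : P 0)
    (hs : ∀ h r hr, P h → P (incr h r hr)) (h : Conf m) : P h := by
  induction hn : ∑ n, (h n : ℕ) generalizing h with
  | zero =>
    have : h = 0 := by
      funext n
      have := Finset.sum_eq_zero_iff.1 hn n (Finset.mem_univ n)
      exact Fin.ext this
    rwa [this]
  | succ k ih =>
    obtain ⟨r, -, hr⟩ : ∃ r ∈ Finset.univ, (h r : ℕ) ≠ 0 := by
      by_contra! h'
      rw [Finset.sum_eq_zero h'] at hn
      omega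
    have hlt := (h r).isLt
    set g : Conf m := Function.update h r ⟨h r - 1, by omega⟩ with hg
    have hgr : (g r : ℕ) = h r - 1 := by simp [hg]
    have hgh : incr g r (by omega) = h := by
      funext n
      by_cases hn : n = r
      · subst hn
        ext
        simp only [incr, Function.update_self, hgr]
        omega
      · simp [incr, hg, hn]
    rw [← hgh]
    refine hs _ _ _ (ih g ?_)
    rw [← Finset.add_sum_erase _ _ (Finset.mem_univ r)] at hn ⊢
    have : ∑ n ∈ Finset.univ.erase r, (g n : ℕ) = ∑ n ∈ Finset.univ.erase r, (h n : ℕ) :=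
      Finset.sum_congr rfl fun n hn => by simp [hg, Finset.ne_of_mem_erase hn]
    omega

theorem ladder_incr {k₁ : ℂ} {F : ℂ → Op m} (hF : ∀ x y, Commute (F x) (F y)) (h : Conf m)
    (r : Fin N) (hr : (h r : ℕ) < m r) :
    ladder m η ξ k₁ F (incr h r hr) = ladder m η ξ k₁ F h *
      ((k₁ * funA m η ξ (node m η ξ r (h r)))⁻¹ • F (node m η ξ r (h r))) := by
  let s : Fin N → ℕ → Op m := fun n k =>
    (List.ofFn fun k : Fin k =>
      (k₁ * funA m η ξ (node m η ξ n k))⁻¹ • F (node m η ξ n k)).prod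
  change (List.ofFn fun n => s n (incr h r hr n)).prod = (List.ofFn fun n => s n (h n)).prod * _
  refine prod_ofFn_mul_of_commute r _ ?_ (fun n hn => ?_) fun n => ?_
  · have : ((incr h r hr r : Fin _) : ℕ) = h r + 1 := by simp [incr]
    rw [this]
    simp only [s]
    rw [List.ofFn_succ', List.concat_eq_append, List.prod_append, List.prod_singleton]
    simp
  · simp [incr, hn]
  · refine Commute.list_prod_right _ _ fun y hy => ?_
    obtain ⟨i, rfl⟩ := (List.mem_ofFn' _ _).1 hy
    exact ((hF _ _).smul_left _).smul_right _

theorem ladder_zero {k₁ : ℂ} {F : ℂ → Op m} : ladder m η ξ k₁ F 0 = 1 := by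
  simp [ladder]

end Ladder

/-! ### Exchange relations of the entries of the monodromy matrix -/

section Entries

variable {N : ℕ} {m : Fin N → ℕ} {η : ℂ} {ξ : Fin N → ℂ} {K : Matrix (Fin 2) (Fin 2) ℂ}

/-- With equal indices the exchange relation reads `(x - y + η) [A(x), A(y)] = 0`. The prefactor and
the one with `x`, `y` swapped add up to `2 η`, so at least one of them is nonzero. -/
theorem opA_commute (hη : η ≠ 0) (x y : ℂ) : Commute (opA m η ξ K x) (opA m η ξ K y) := by
  have h : ∀ x y, (x - y + η) •
      (opA m η ξ K x * opA m η ξ K y - opA m η ξ K y * opA m η ξ K x) = 0 := by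
    intro x y
    have := monodromy_exchange (m := m) (η := η) ξ K x y 0 0 0 0
    simp only [opA]
    linear_combination (norm := module) this
  rcases smul_eq_zero.1 (h x y) with h1 | h1
  · rcases smul_eq_zero.1 (h y x) with h2 | h2
    · exact absurd (by linear_combination (h1 + h2) / 2) hη
    · exact (sub_eq_zero.1 h2).symm
  · exact sub_eq_zero.1 h1

theorem opA_mul_opB (x y : ℂ) : (x - y) • (opA m η ξ K y * opB m η ξ K x) =
    (x - y + η) • (opB m η ξ K x * opA m η ξ K y) - η • (opB m η ξ K y * opA m η ξ K x) := by
  have := monodromy_exchange (m := m) (η := η) ξ K x y 0 1 0 0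
  simp only [opA, opB]
  linear_combination (norm := module) -this

theorem opD_mul_opB (x y : ℂ) : (x - y) • (opD m η ξ K y * opB m η ξ K x) =
    (x - y - η) • (opB m η ξ K x * opD m η ξ K y) + η • (opB m η ξ K y * opD m η ξ K x) := by
  have := monodromy_exchange (m := m) (η := η) ξ K y x 1 1 0 1
  simp only [opD, opB]
  linear_combination (norm := module) -this

theorem opA_mul_opD (x : ℂ) :
    opA m η ξ K x * opD m η ξ K (x - η) - opB m η ξ K x * opC m η ξ K (x - η) =
      (K.det * (funA m η ξ x * funD m η ξ (x - η))) • (1 : Op m) := by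
  have h := congrFun (congrFun (monodromy_hasQDet (m := m) (η := η) ξ K x) 0) 0
  simpa [opA, opB, opC, opD, adj, Matrix.mul_apply, Fin.sum_univ_two, ← sub_eq_add_neg] using h

theorem opB_continuous : Continuous (opB m η ξ K) :=
  (monodromy_hasLead ξ K 0 1).continuous

theorem opC_continuous : Continuous (opC m η ξ K) :=
  (monodromy_hasLead ξ K 1 0).continuous

/-- The exchange relations carry a factor `x - y` that can be cancelled only away from `y`;
continuity supplies the missing point. -/
theorem vecMul_opB_eq_of_ne {w : Conf m → ℂ} {e : ℂ → ℂ} (he : Continuous e) (y : ℂ)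
    (h : ∀ x, x ≠ y → w ᵥ* opB m η ξ K x = e x • w) (x : ℂ) :
    w ᵥ* opB m η ξ K x = e x • w := by
  refine congrFun (eq_of_eq_off_finite (f := fun x => w ᵥ* opB m η ξ K x)
    (g := fun x => e x • w) (Continuous.matrix_vecMul continuous_const opB_continuous)
    (he.smul continuous_const) (Set.finite_singleton y) fun x hx => h x hx) x

variable {b : ℂ} {u : Conf m → ℂ} {z : Fin N → ℂ}

theorem prod_update_sub (x c : ℂ) (r : Fin N) :
    ∏ n, (x - Function.update z r c n) = (x - c) * ∏ n ∈ Finset.univ.erase r, (x - z n) := by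
  rw [← Finset.mul_prod_erase _ _ (Finset.mem_univ r), Function.update_self]
  congr 1
  exact Finset.prod_congr rfl fun n hn => by
    rw [Function.update_of_ne (Finset.ne_of_mem_erase hn)]

theorem vecMul_opB_at_root
    (hu : ∀ x, u ᵥ* opB m η ξ K x = (b * ∏ n, (x - z n)) • u) (r : Fin N) :
    u ᵥ* opB m η ξ K (z r) = 0 := by
  rw [hu, Finset.prod_eq_zero (Finset.mem_univ r) (sub_self _), mul_zero, zero_smul]

/-- At `y = z r` the term `B(y) A(x)` is killed by `u B(z r) = 0`. What remains is the old
eigenvalue times `(x - z r + η) / (x - z r)`, which trades the root `z r` for `z r - η`. -/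
theorem vecMul_opA_opB (hu : ∀ x, u ᵥ* opB m η ξ K x = (b * ∏ n, (x - z n)) • u) (r : Fin N)
    (x : ℂ) : (u ᵥ* opA m η ξ K (z r)) ᵥ* opB m η ξ K x =
      (b * ∏ n, (x - Function.update z r (z r - η) n)) • (u ᵥ* opA m η ξ K (z r)) := by
  revert x
  refine vecMul_opB_eq_of_ne (by fun_prop) (z r) fun x hx => ?_
  refine smul_right_injective _ (sub_ne_zero.2 hx) ?_
  have h := congrArg (u ᵥ* ·) (opA_mul_opB (m := m) (η := η) (ξ := ξ) (K := K) x (z r))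
  simp only [Matrix.vecMul_sub, Matrix.vecMul_smul, ← Matrix.vecMul_vecMul, hu x,
    vecMul_opB_at_root hu r, Matrix.zero_vecMul, smul_zero, sub_zero, Matrix.smul_vecMul,
    smul_smul] at h
  simp only [h, smul_smul]
  congr 1
  rw [prod_update_sub, ← Finset.mul_prod_erase _ _ (Finset.mem_univ r)]
  ring

theorem vecMul_opD_opB (hu : ∀ x, u ᵥ* opB m η ξ K x = (b * ∏ n, (x - z n)) • u) (r : Fin N)
    (x : ℂ) : (u ᵥ* opD m η ξ K (z r)) ᵥ* opB m η ξ K x =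
      (b * ∏ n, (x - Function.update z r (z r + η) n)) • (u ᵥ* opD m η ξ K (z r)) := by
  revert x
  refine vecMul_opB_eq_of_ne (by fun_prop) (z r) fun x hx => ?_
  refine smul_right_injective _ (sub_ne_zero.2 hx) ?_
  have h := congrArg (u ᵥ* ·) (opD_mul_opB (m := m) (η := η) (ξ := ξ) (K := K) x (z r))
  simp only [Matrix.vecMul_add, Matrix.vecMul_smul, ← Matrix.vecMul_vecMul, hu x,
    vecMul_opB_at_root hu r, Matrix.zero_vecMul, smul_zero, add_zero, Matrix.smul_vecMul,
    smul_smul] at h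
  simp only [h, smul_smul]
  congr 1
  rw [prod_update_sub, ← Finset.mul_prod_erase _ _ (Finset.mem_univ r)]
  ring

end Entries

/-! ### The basis of eigencovectors -/

section Basis

variable {N : ℕ} {m : Fin N → ℕ} {η : ℂ} {ξ : Fin N → ℂ} {K : Matrix (Fin 2) (Fin 2) ℂ} {k₁ k₂ : ℂ}

theorem node_succ (n : Fin N) (k : ℕ) : node m η ξ n (k + 1) = node m η ξ n k - η := by
  simp only [node]; push_cast; ring

/-- The zeros of `funA` are the lower ends of the strings and those of `funD` the upper ends. Hence
raising and lowering coefficients are nonzero for steps that stay inside a string. -/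
theorem funA_eq (x : ℂ) : funA m η ξ x = ∏ n, (x - node m η ξ n (m n)) :=
  Finset.prod_congr rfl fun n _ => by simp only [node]; ring

theorem funD_eq (x : ℂ) : funD m η ξ x = ∏ n, (x - node m η ξ n 0) :=
  Finset.prod_congr rfl fun n _ => by simp only [node]; push_cast; ring

theorem node_injective (hη : η ≠ 0) (n : Fin N) : Function.Injective (node m η ξ n) := by
  intro k l h
  simp only [node] at h
  have : ((k : ℂ) - l) * η = 0 := by linear_combination -h
  rcases mul_eq_zero.1 this with h | h
  · exact_mod_cast sub_eq_zero.1 h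
  · exact absurd h hη

theorem update_node (h : Conf m) (r : Fin N) (k : Fin (m r + 1)) :
    (fun n => node m η ξ n (Function.update h r k n)) =
      Function.update (fun n => node m η ξ n (h n)) r (node m η ξ r k) := by
  funext n
  by_cases hn : n = r
  · subst hn; simp
  · simp [hn]

variable (hη : η ≠ 0)
  (hnode : ∀ a b : Fin N, a ≠ b → ∀ k ≤ m a, ∀ l ≤ m b, node m η ξ a k ≠ node m η ξ b l)

include hη hnode

theorem node_ne {r n : Fin N} {k l : ℕ} (hk : k ≤ m r) (hl : l ≤ m n) (h : r = n → k ≠ l) :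
    node m η ξ r k ≠ node m η ξ n l := by
  by_cases hrn : r = n
  · subst hrn
    exact (node_injective hη r).ne (h rfl)
  · exact hnode r n hrn k hk l hl

theorem funA_node_ne_zero {r : Fin N} {k : ℕ} (hk : k < m r) :
    funA m η ξ (node m η ξ r k) ≠ 0 := by
  rw [funA_eq]
  exact Finset.prod_ne_zero_iff.2 fun n _ => sub_ne_zero.2
    (node_ne hη hnode hk.le le_rfl fun h => by subst h; exact hk.ne)

theorem funD_node_ne_zero {r : Fin N} {k : ℕ} (h0 : k ≠ 0) (hk : k ≤ m r) :
    funD m η ξ (node m η ξ r k) ≠ 0 := by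
  rw [funD_eq]
  exact Finset.prod_ne_zero_iff.2 fun n _ => sub_ne_zero.2
    (node_ne hη hnode hk (Nat.zero_le _) fun _ => h0)

omit hη in
theorem node_conf_injective (h : Conf m) : Function.Injective fun n => node m η ξ n (h n) := by
  intro a b hab
  by_contra hne
  exact hnode a b hne _ (Nat.lt_succ_iff.1 (h a).isLt) _ (Nat.lt_succ_iff.1 (h b).isLt) hab

omit hη in
theorem normalization_ne_zero : normalization m η ξ ≠ 0 := by
  refine Finset.prod_ne_zero_iff.2 fun a _ => Finset.prod_ne_zero_iff.2 fun b hb => ?_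
  have hba : b < a := (Finset.mem_filter.1 hb).2
  have h := sub_ne_zero.2 (hnode a b hba.ne' 0 (Nat.zero_le _) 0 (Nat.zero_le _))
  exact fun h0 => h ((Complex.cpow_eq_zero_iff _ _).1 h0).1

theorem eigB_injective {b : ℂ} (hb : b ≠ 0) : Function.Injective (eigB m η ξ b) := by
  intro h h' e
  funext r
  by_contra hr
  -- This point is a root of the eigenvalue of `h'`, but not of that of `h`, because `h r ≠ h' r`
  -- and the strings are disjoint.
  have h1 := congrFun e (node m η ξ r (h' r))
  simp only [eigB] at h1
  rw [Finset.prod_eq_zero (s := Finset.univ) (f := fun n => node m η ξ r (h' r) -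
    node m η ξ n (h' n)) (Finset.mem_univ r) (sub_self _), mul_zero] at h1
  refine mul_ne_zero hb (Finset.prod_ne_zero_iff.2 fun n _ => sub_ne_zero.2 ?_) h1
  refine node_ne hη hnode (Nat.lt_succ_iff.1 (h' r).isLt) (Nat.lt_succ_iff.1 (h n).isLt) ?_
  rintro rfl h2
  exact hr (Fin.ext h2.symm)

theorem skCovector_incr (hk₁ : k₁ ≠ 0) (h : Conf m) (r : Fin N) (hr : (h r : ℕ) < m r) :
    skCovector m η ξ K k₁ h ᵥ* opA m η ξ K (node m η ξ r (h r)) =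
      (k₁ * funA m η ξ (node m η ξ r (h r))) • skCovector m η ξ K k₁ (incr h r hr) := by
  have ha := mul_ne_zero hk₁ (funA_node_ne_zero hη hnode hr)
  simp only [skCovector]
  rw [ladder_incr (fun x y => opA_commute hη x y) h r hr, mul_smul_comm, Matrix.vecMul_smul,
    smul_comm _ (normalization m η ξ)⁻¹, smul_smul (k₁ * _), mul_inv_cancel₀ ha, one_smul,
    Matrix.smul_vecMul, Matrix.vecMul_vecMul]

theorem skCovector_vecMul_opB (hk₁ : k₁ ≠ 0) (h : Conf m) (x : ℂ) :
    skCovector m η ξ K k₁ h ᵥ* opB m η ξ K x =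
      eigB m η ξ (K 0 1) h x • skCovector m η ξ K k₁ h := by
  revert x
  induction h using conf_induction with
  | h0 =>
    intro x
    simp only [skCovector, ladder_zero, Matrix.vecMul_one, Matrix.smul_vecMul,
      refCovector_vecMul_opB, funD_eq, eigB]
    rw [smul_comm]
    rfl
  | hs h r hr ih =>
    intro x
    have ha := mul_ne_zero hk₁ (funA_node_ne_zero hη hnode hr)
    have h1 := vecMul_opA_opB (z := fun n => node m η ξ n (h n)) ih r x
    beta_reduce at h1
    rw [skCovector_incr hη hnode hk₁ h r hr, Matrix.smul_vecMul, smul_comm] at h1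
    have h2 := smul_right_injective _ ha h1
    rw [h2, ← node_succ]
    have h3 := update_node (η := η) (ξ := ξ) h r ⟨h r + 1, by omega⟩
    simp only [eigB, incr, ← h3]

variable (hk : k₁ * k₂ = K.det) (hdet : K.det ≠ 0)

include hk hdet

/-- At the root `node m η ξ r (h r)` the B-C term of the quantum determinant drops out, leaving A
followed by D equal to the scalar `k₁ k₂ a(x) d(x - η)`; the normalization of the ladder removes `k₁
a(x)`. -/
theorem skCovector_incr_vecMul_opD (h : Conf m) (r : Fin N) (hr : (h r : ℕ) < m r) :
    skCovector m η ξ K k₁ (incr h r hr) ᵥ* opD m η ξ K (node m η ξ r (h r + 1)) =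
      (k₂ * funD m η ξ (node m η ξ r (h r + 1))) • skCovector m η ξ K k₁ h := by
  have hk₁ : k₁ ≠ 0 := fun h => hdet (by rw [← hk, h, zero_mul])
  have ha := mul_ne_zero hk₁ (funA_node_ne_zero hη hnode hr)
  refine smul_right_injective _ ha ?_
  have h1 := congrArg (skCovector m η ξ K k₁ h ᵥ* ·)
    (opA_mul_opD (m := m) (η := η) (ξ := ξ) (K := K) (node m η ξ r (h r)))
  simp only [Matrix.vecMul_sub, ← Matrix.vecMul_vecMul, Matrix.vecMul_smul, Matrix.vecMul_one] at h1
  rw [vecMul_opB_at_root (z := fun n => node m η ξ n (h n)) (b := K 0 1)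
    (skCovector_vecMul_opB hη hnode hk₁ h) r, Matrix.zero_vecMul, sub_zero,
    skCovector_incr hη hnode hk₁ h r hr, Matrix.smul_vecMul, ← node_succ, ← hk] at h1
  simp only [h1, smul_smul]
  congr 1
  ring

/-- If a raised covector vanished, lowering it by D would give a nonzero multiple of the previous
one, which is nonzero by induction. -/
theorem skCovector_ne_zero (h : Conf m) : skCovector m η ξ K k₁ h ≠ 0 := by
  have hk₂ : k₂ ≠ 0 := fun h => hdet (by rw [← hk, h, mul_zero])
  induction h using conf_induction with
  | h0 =>
    intro h0
    have h1 := congrFun h0 0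
    simp [skCovector, ladder_zero, refCovector, normalization_ne_zero hnode] at h1
  | hs h r hr ih =>
    intro h0
    have h1 := skCovector_incr_vecMul_opD hη hnode hk hdet h r hr
    rw [h0, Matrix.zero_vecMul, eq_comm, smul_eq_zero] at h1
    exact h1.elim (mul_ne_zero hk₂ (funD_node_ne_zero hη hnode (Nat.succ_ne_zero _) hr)) ih

variable (hb : K 0 1 ≠ 0)

include hb

theorem skCovector_linearIndependent : LinearIndependent ℂ (skCovector m η ξ K k₁) := by
  have hk₁ : k₁ ≠ 0 := fun h => hdet (by rw [← hk, h, zero_mul])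
  let p : Conf m → Polynomial ℂ := fun h =>
    Polynomial.C (K 0 1) * ∏ n, (Polynomial.X - Polynomial.C (node m η ξ n (h n)))
  have hp : ∀ h x, (p h).eval x = eigB m η ξ (K 0 1) h x := fun h x => by
    simp [p, eigB, Polynomial.eval_prod]
  have hinj : Function.Injective p := fun h h' e =>
    eigB_injective hη hnode hb (funext fun x => by rw [← hp, ← hp, e])
  obtain ⟨x, hx⟩ := exists_eval_injective hinj
  simp only [hp] at hx
  refine Module.End.eigenvectors_linearIndependent' (Matrix.vecMulLinear (opB m η ξ K x)) _ hx _
    fun h => ⟨Module.End.mem_eigenspace_iff.2 ?_, skCovector_ne_zero hη hnode hk hdet h⟩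
  exact skCovector_vecMul_opB hη hnode hk₁ h x

theorem skCovector_span : Submodule.span ℂ (Set.range (skCovector m η ξ K k₁)) = ⊤ :=
  (skCovector_linearIndependent hη hnode hk hdet hb).span_eq_top_of_card_eq_finrank'
    (Module.finrank_fintype_fun_eq_card ℂ).symm

/-- In the eigenbasis, the eigenvalue of the covector labelled `h` vanishes at its own node on
string `r`, where the eigenvalue of `u` does not. So every coefficient of `u` is zero. -/
theorem eq_zero_of_vecMul_opB {u : Conf m → ℂ} {z : Fin N → ℂ}
    (hu : ∀ x, u ᵥ* opB m η ξ K x = (K 0 1 * ∏ n, (x - z n)) • u) (r : Fin N)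
    (hz : ∀ k ≤ m r, ∀ n, node m η ξ r k ≠ z n) : u = 0 := by
  have hk₁ : k₁ ≠ 0 := fun h => hdet (by rw [← hk, h, zero_mul])
  have hmem : u ∈ Submodule.span ℂ (Set.range (skCovector m η ξ K k₁)) := by
    rw [skCovector_span hη hnode hk hdet hb]; trivial
  obtain ⟨c, hc⟩ := (Submodule.mem_span_range_iff_exists_fun ℂ).1 hmem
  have hli := Fintype.linearIndependent_iff.1 (skCovector_linearIndependent hη hnode hk hdet hb)
  have hc0 : ∀ h, c h = 0 := by
    intro h
    set x := node m η ξ r (h r) with hx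
    have h1 := hu x
    rw [← hc, Matrix.sum_vecMul, Finset.smul_sum, ← sub_eq_zero, ← Finset.sum_sub_distrib] at h1
    have h2 := hli (fun h => c h * (eigB m η ξ (K 0 1) h x - K 0 1 * ∏ n, (x - z n))) (by
      rw [← h1]
      refine Finset.sum_congr rfl fun h' _ => ?_
      rw [Matrix.smul_vecMul, skCovector_vecMul_opB hη hnode hk₁]
      module) h
    have h3 : eigB m η ξ (K 0 1) h x = 0 := by
      rw [eigB, Finset.prod_eq_zero (Finset.mem_univ r) (sub_self _), mul_zero]
    rw [h3, zero_sub] at h2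
    refine (mul_eq_zero.1 h2).resolve_right (neg_ne_zero.2 (mul_ne_zero hb ?_))
    exact Finset.prod_ne_zero_iff.2 fun n _ =>
      sub_ne_zero.2 (hz _ (Nat.lt_succ_iff.1 (h r).isLt) n)
  rw [← hc]
  simp [hc0]

/-- Inside the string this is the definition of the ladder. At its lower end the root would move to
`node m η ξ r (m r + 1)`; then no root of the new eigenvalue lies on string `r`, and the covector
vanishes. -/
theorem skCovector_vecMul_opA_node (h : Conf m) (r : Fin N) :
    skCovector m η ξ K k₁ h ᵥ* opA m η ξ K (node m η ξ r (h r)) =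
      (k₁ * funA m η ξ (node m η ξ r (h r))) • shift (skCovector m η ξ K k₁) h r 1 := by
  have hk₁ : k₁ ≠ 0 := fun h => hdet (by rw [← hk, h, zero_mul])
  have hlt := (h r).isLt
  by_cases hr : (h r : ℕ) < m r
  · rw [skCovector_incr hη hnode hk₁ h r hr, shift, dif_pos (by omega)]
    rfl
  · rw [shift, dif_neg (by omega), smul_zero]
    refine eq_zero_of_vecMul_opB hη hnode hk hdet hb
      (vecMul_opA_opB (z := fun n => node m η ξ n (h n))
        (skCovector_vecMul_opB hη hnode hk₁ h) r) r fun k hkr n => ?_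
    by_cases hn : n = r
    · subst hn
      rw [Function.update_self, ← node_succ]
      exact (node_injective hη n).ne (by omega)
    · rw [Function.update_of_ne hn]
      exact hnode _ _ (Ne.symm hn) _ hkr _ (Nat.lt_succ_iff.1 (h n).isLt)

theorem skCovector_vecMul_opD_node (h : Conf m) (r : Fin N) :
    skCovector m η ξ K k₁ h ᵥ* opD m η ξ K (node m η ξ r (h r)) =
      (k₂ * funD m η ξ (node m η ξ r (h r))) • shift (skCovector m η ξ K k₁) h r (-1) := by
  have hk₁ : k₁ ≠ 0 := fun h => hdet (by rw [← hk, h, zero_mul])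
  have hlt := (h r).isLt
  by_cases hr : (h r : ℕ) = 0
  · rw [shift, dif_neg (by omega), smul_zero]
    refine eq_zero_of_vecMul_opB hη hnode hk hdet hb
      (vecMul_opD_opB (z := fun n => node m η ξ n (h n))
        (skCovector_vecMul_opB hη hnode hk₁ h) r) r fun k hkr n => ?_
    by_cases hn : n = r
    · subst hn
      rw [Function.update_self, hr]
      -- The root lies one step above the string, at label `-1`, which `node_injective` does not
      -- cover; the comparison is made by hand.
      intro h0
      simp only [node] at h0
      have h1 : ((k : ℂ) + 1) * η = 0 := by push_cast at h0; linear_combination -h0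
      rcases mul_eq_zero.1 h1 with h1 | h1
      · exact Nat.cast_add_one_ne_zero k h1
      · exact hη h1
    · rw [Function.update_of_ne hn]
      exact hnode _ _ (Ne.symm hn) _ hkr _ (Nat.lt_succ_iff.1 (h n).isLt)
  · rw [shift, dif_pos (by omega)]
    set g : Conf m := Function.update h r ⟨(((h r : ℕ) : ℤ) + -1).toNat, by omega⟩ with hg
    have hgr : (g r : ℕ) + 1 = h r := by simp [hg]; omega
    have hgh : incr g r (by omega) = h := by
      funext n
      by_cases hn : n = r
      · subst hn
        ext
        simp only [incr, Function.update_self, hgr]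
      · simp [incr, hg, hn]
    have h1 := skCovector_incr_vecMul_opD hη hnode hk hdet g r (by omega)
    rwa [hgh, hgr] at h1

theorem skCovector_vecMul_opA (h : Conf m) (x : ℂ) :
    skCovector m η ξ K k₁ h ᵥ* opA m η ξ K x =
      (K 0 0 * ∏ n, (x - node m η ξ n (h n))) • skCovector m η ξ K k₁ h +
        ∑ a, (interp m η ξ h a x * (k₁ * funA m η ξ (node m η ξ a (h a)))) •
          shift (skCovector m η ξ K k₁) h a 1 := by
  have h1 := (monodromy_hasLead (m := m) (η := η) ξ K 0 0).vecMul_eq _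
    (node_conf_injective hnode h) (skCovector m η ξ K k₁ h) x
  rw [opA, h1]
  congr 1
  refine Finset.sum_congr rfl fun r _ => ?_
  rw [← smul_smul, ← skCovector_vecMul_opA_node hη hnode hk hdet hb]
  rfl

theorem skCovector_vecMul_opD (h : Conf m) (x : ℂ) :
    skCovector m η ξ K k₁ h ᵥ* opD m η ξ K x =
      (K 1 1 * ∏ n, (x - node m η ξ n (h n))) • skCovector m η ξ K k₁ h +
        ∑ a, (interp m η ξ h a x * (k₂ * funD m η ξ (node m η ξ a (h a)))) •
          shift (skCovector m η ξ K k₁) h a (-1) := by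
  have h1 := (monodromy_hasLead (m := m) (η := η) ξ K 1 1).vecMul_eq _
    (node_conf_injective hnode h) (skCovector m η ξ K k₁ h) x
  rw [opD, h1]
  congr 1
  refine Finset.sum_congr rfl fun r _ => ?_
  rw [← smul_smul, ← skCovector_vecMul_opD_node hη hnode hk hdet hb]
  rfl

theorem opC_unique {X : ℂ → Op m} (hX : Continuous X)
    (h : ∀ x, opA m η ξ K x * opD m η ξ K (x - η) - opB m η ξ K x * X (x - η) =
      (K.det * (funA m η ξ x * funD m η ξ (x - η))) • (1 : Op m)) : X = opC m η ξ K := by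
  have hk₁ : k₁ ≠ 0 := fun h => hdet (by rw [← hk, h, zero_mul])
  -- At `x` the relation involves B at `x + η`, whose eigenvalues vanish only at nodes; hence the
  -- shift by `-η` in the exceptional set.
  refine eq_of_eq_off_finite hX opC_continuous (s := Set.range fun p : (n : Fin N) × Fin (m n + 1) =>
    node m η ξ p.1 p.2 - η) (Set.finite_range _) fun x hx => ?_
  have h1 := (h (x + η)).trans (opA_mul_opD (x + η)).symm
  rw [add_sub_cancel_right, sub_right_inj] at h1
  have h2 : ∀ g, skCovector m η ξ K k₁ g ᵥ* (X x - opC m η ξ K x) = 0 := by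
    intro g
    have h3 := congrArg (skCovector m η ξ K k₁ g ᵥ* ·) h1
    simp only [← Matrix.vecMul_vecMul, skCovector_vecMul_opB hη hnode hk₁,
      Matrix.smul_vecMul] at h3
    rw [Matrix.vecMul_sub, sub_eq_zero]
    refine smul_right_injective _ (mul_ne_zero hb (Finset.prod_ne_zero_iff.2 fun n _ => ?_)) h3
    rw [sub_ne_zero]
    exact fun h4 => hx ⟨⟨n, g n⟩, by simp [← h4]⟩
  have h3 : Matrix.vecMulLinear (X x - opC m η ξ K x) = 0 := by
    refine LinearMap.ext_on_range (skCovector_span hη hnode hk hdet hb) fun g => ?_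
    exact h2 g
  rw [← sub_eq_zero]
  ext i j
  have h4 := congrFun (LinearMap.congr_fun h3 (Pi.single i 1)) j
  simpa using h4

end Basis

/-! ### The symmetric power of a `2 × 2` matrix -/

section Fused

variable (q : ℕ)

/-- The `q`-th symmetric power of a vector of `ℂ²`. -/
def coh (v : Fin 2 → ℂ) (k : Fin (q + 1)) : ℂ :=
  ((Real.sqrt (q.choose k) : ℝ) : ℂ) * (v 0 ^ (q - (k : ℕ)) * v 1 ^ (k : ℕ))

/-- The partial derivatives of `coh`. -/
def dcoh (v : Fin 2 → ℂ) : Fin 2 → Fin (q + 1) → ℂ :=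
  ![fun k => ((Real.sqrt (q.choose k) : ℝ) : ℂ) *
      (((q - (k : ℕ) : ℕ) : ℂ) * v 0 ^ (q - (k : ℕ) - 1) * v 1 ^ (k : ℕ)),
    fun k => ((Real.sqrt (q.choose k) : ℝ) : ℂ) *
      (v 0 ^ (q - (k : ℕ)) * (((k : ℕ) : ℂ) * v 1 ^ ((k : ℕ) - 1)))]

variable {q}

theorem sqrt_choose_ne_zero (k : Fin (q + 1)) : ((Real.sqrt (q.choose k) : ℝ) : ℂ) ≠ 0 := by
  have h : 0 < q.choose k := Nat.choose_pos (Nat.lt_succ_iff.1 k.isLt)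
  exact_mod_cast (Real.sqrt_pos.2 (by exact_mod_cast h)).ne'

theorem prod_eq_pow_downs (v : Fin 2 → ℂ) (f : Fin q → Fin 2) :
    ∏ i, v (f i) = v 0 ^ (q - downs f) * v 1 ^ downs f := by
  have h : ∀ i, v (f i) = if f i = 1 then v 1 else v 0 := by
    intro i
    split_ifs with h
    · rw [h]
    · rw [show f i = 0 by omega]
  simp only [h]
  rw [Finset.prod_ite, Finset.prod_const, Finset.prod_const, mul_comm]
  congr 2
  have := Finset.card_filter_add_card_filter_not (s := (Finset.univ : Finset (Fin q)))
    (fun i => f i = 1)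
  rw [Finset.card_univ, Fintype.card_fin] at this
  rw [downs]
  omega

theorem card_downs (k : ℕ) :
    (Finset.univ.filter fun f : Fin q → Fin 2 => downs f = k).card = q.choose k := by
  have h : (Finset.powersetCard k (Finset.univ : Finset (Fin q))).card = q.choose k := by simp
  rw [← h]
  refine Finset.card_nbij' (fun f => Finset.univ.filter fun i => f i = 1)
    (fun s i => if i ∈ s then 1 else 0) ?_ ?_ ?_ ?_
  · intro f hf
    exact Finset.mem_powersetCard.2 ⟨Finset.subset_univ _, (Finset.mem_filter.1 hf).2⟩
  · intro s hs
    refine Finset.mem_filter.2 ⟨Finset.mem_univ _, ?_⟩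
    rw [← (Finset.mem_powersetCard.1 hs).2]
    simp [downs]
  · intro f _
    funext i
    by_cases h : f i = 1
    · simp [h]
    · simp [show f i = 0 by omega]
  · intro s _
    ext i
    simp

theorem downs_lt (f : Fin q → Fin 2) : downs f < q + 1 :=
  Nat.lt_succ_iff.2 ((Finset.card_le_univ _).trans (Fintype.card_fin q).le)

/-- This is `W^{⊗q} v^{⊗q} = (W v)^{⊗q}` in weight coordinates: `coh q v` represents `v^{⊗q}`, whose
component along `f` depends only on `downs f`. -/
theorem fused_mulVec_coh (W : Matrix (Fin 2) (Fin 2) ℂ) (v : Fin 2 → ℂ) :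
    fused q W *ᵥ coh q v = coh q (W *ᵥ v) := by
  funext j
  have hj := sqrt_choose_ne_zero j
  have h1 : ∀ k, fused q W j k * coh q v k = (((Real.sqrt (q.choose j) : ℝ) : ℂ))⁻¹ *
      ∑ g ∈ Finset.univ.filter (fun g : Fin q → Fin 2 => downs g = k),
        ∑ f ∈ Finset.univ.filter (fun f : Fin q → Fin 2 => downs f = j),
          ∏ i, (W (f i) (g i) * v (g i)) := by
    intro k
    have hk := sqrt_choose_ne_zero k
    have h2 : ∀ g ∈ Finset.univ.filter (fun g : Fin q → Fin 2 => downs g = k),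
        ∑ f ∈ Finset.univ.filter (fun f : Fin q → Fin 2 => downs f = j),
          ∏ i, (W (f i) (g i) * v (g i)) =
        (∑ f ∈ Finset.univ.filter (fun f : Fin q → Fin 2 => downs f = j),
          ∏ i, W (f i) (g i)) * (v 0 ^ (q - (k : ℕ)) * v 1 ^ (k : ℕ)) := by
      intro g hg
      rw [← (Finset.mem_filter.1 hg).2, ← prod_eq_pow_downs, Finset.sum_mul]
      simp only [Finset.prod_mul_distrib]
    rw [Finset.sum_congr rfl h2, ← Finset.sum_mul, Finset.sum_comm, fused, Matrix.of_apply, coh,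
      Real.sqrt_mul (Nat.cast_nonneg _)]
    push_cast
    field_simp
  rw [Matrix.mulVec, dotProduct, Finset.sum_congr rfl fun k _ => h1 k, ← Finset.mul_sum]
  have h3 : ∀ φ : (Fin q → Fin 2) → ℂ, ∑ k : Fin (q + 1),
      ∑ g ∈ Finset.univ.filter (fun g : Fin q → Fin 2 => downs g = k), φ g = ∑ g, φ g := by
    intro φ
    rw [← Finset.sum_fiberwise Finset.univ (fun g => (⟨downs g, downs_lt g⟩ : Fin (q + 1))) φ]
    simp only [Fin.ext_iff]
  rw [h3, Finset.sum_comm]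
  have h4 : ∀ f ∈ Finset.univ.filter (fun f : Fin q → Fin 2 => downs f = j),
      ∑ g : Fin q → Fin 2, ∏ i, (W (f i) (g i) * v (g i)) =
        (W *ᵥ v) 0 ^ (q - (j : ℕ)) * (W *ᵥ v) 1 ^ (j : ℕ) := by
    intro f hf
    rw [← (Finset.mem_filter.1 hf).2, ← prod_eq_pow_downs]
    simp only [Matrix.mulVec, dotProduct]
    rw [Finset.prod_univ_sum, Fintype.piFinset_univ]
  rw [Finset.sum_congr rfl h4, Finset.sum_const, card_downs, nsmul_eq_mul, coh]
  have h5 : ((q.choose j : ℕ) : ℂ) =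
      ((Real.sqrt (q.choose j) : ℝ) : ℂ) * ((Real.sqrt (q.choose j) : ℝ) : ℂ) := by
    rw [sqrt_mul_self_cast (Nat.cast_nonneg _)]; push_cast; rfl
  rw [h5]
  field_simp

/-- The vectors `coh q ![1, t]` already span: each row of a matrix is recovered from the
coefficients of a polynomial in `t`. Identities for `fused` thus reduce to coherent vectors. -/
theorem eq_of_mulVec_coh {X Y : Matrix (Fin (q + 1)) (Fin (q + 1)) ℂ}
    (h : ∀ v, X *ᵥ coh q v = Y *ᵥ coh q v) : X = Y := by
  ext i k
  let p (Z : Matrix (Fin (q + 1)) (Fin (q + 1)) ℂ) : Polynomial ℂ :=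
    ∑ k : Fin (q + 1), Polynomial.monomial (k : ℕ) (Z i k * ((Real.sqrt (q.choose k) : ℝ) : ℂ))
  have hp : ∀ Z t, (p Z).eval t = (Z *ᵥ coh q ![1, t]) i := by
    intro Z t
    simp [p, Polynomial.eval_finsetSum, Matrix.mulVec, dotProduct, coh, mul_assoc]
  have hc : ∀ Z, (p Z).coeff k = Z i k * ((Real.sqrt (q.choose k) : ℝ) : ℂ) := by
    intro Z
    simp [p, Polynomial.finsetSum_coeff, Polynomial.coeff_monomial, Fin.val_inj]
  have hXY : p X = p Y := Polynomial.funext fun t => by rw [hp, hp, h]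
  exact mul_right_cancel₀ (sqrt_choose_ne_zero k) (by rw [← hc, ← hc, hXY])

theorem fused_mul (W W' : Matrix (Fin 2) (Fin 2) ℂ) :
    fused q (W * W') = fused q W * fused q W' :=
  eq_of_mulVec_coh fun v => by
    rw [← Matrix.mulVec_mulVec, fused_mulVec_coh, fused_mulVec_coh, fused_mulVec_coh,
      Matrix.mulVec_mulVec]

theorem fused_one : fused q 1 = 1 :=
  eq_of_mulVec_coh fun v => by rw [fused_mulVec_coh, Matrix.one_mulVec, Matrix.one_mulVec]

theorem hasDerivAt_coh (v w : Fin 2 → ℂ) :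
    HasDerivAt (fun t : ℂ => coh q (v + t • w)) (w 0 • dcoh q v 0 + w 1 • dcoh q v 1) 0 := by
  refine hasDerivAt_pi.2 fun k => ?_
  have h : ∀ i, HasDerivAt (fun t : ℂ => (v + t • w) i) (w i) 0 := by
    intro i
    simpa using ((hasDerivAt_id (0 : ℂ)).mul_const (w i)).const_add (v i)
  have h1 := (((h 0).pow (q - (k : ℕ))).mul ((h 1).pow (k : ℕ))).const_mul
    ((Real.sqrt (q.choose k) : ℝ) : ℂ)
  refine h1.congr_deriv ?_
  simp [dcoh]
  ring

/-- The chain rule: differentiate `fused_mulVec_coh` along the `j`-th basis direction. -/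
theorem fused_mulVec_dcoh (W : Matrix (Fin 2) (Fin 2) ℂ) (v : Fin 2 → ℂ) (j : Fin 2) :
    fused q W *ᵥ dcoh q v j = ∑ l, W l j • dcoh q (W *ᵥ v) l := by
  have h1 := ((Matrix.mulVecLin (fused q W)).toContinuousLinearMap.hasFDerivAt).comp_hasDerivAt 0
    (hasDerivAt_coh v (Pi.single j 1))
  have h2 := hasDerivAt_coh (q := q) (W *ᵥ v) (W *ᵥ Pi.single j 1)
  have h3 : (fun t : ℂ => coh q (W *ᵥ v + t • W *ᵥ Pi.single j 1)) =
      (Matrix.mulVecLin (fused q W)).toContinuousLinearMap ∘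
        fun t : ℂ => coh q (v + t • Pi.single j 1) := by
    funext t
    simp [fused_mulVec_coh, Matrix.mulVec_add, Matrix.mulVec_smul]
  rw [h3] at h2
  have h4 := h1.unique h2
  fin_cases j <;> simpa [Fin.sum_univ_two] using h4

/-- The `gl₂` generators in the representation of spin `q / 2`. -/
def spinGen (q : ℕ) : Fin 2 → Fin 2 → Matrix (Fin (q + 1)) (Fin (q + 1)) ℂ :=
  ![![spinZ q, spinMinus q], ![spinPlus q, -spinZ q]]

theorem spinPlus_mulVec_coh (v : Fin 2 → ℂ) : spinPlus q *ᵥ coh q v = v 1 • dcoh q v 0 := by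
  funext i
  have hi := i.isLt
  rw [Matrix.mulVec, dotProduct]
  by_cases h : (i : ℕ) < q
  · rw [Finset.sum_eq_single ⟨(i : ℕ) + 1, by omega⟩]
    · have hC : ((i : ℕ) + 1 : ℝ) * (q.choose (i + 1) : ℝ) = (q - (i : ℕ)) * (q.choose i : ℝ) := by
        have := Nat.choose_succ_right_eq q i
        rw [← Nat.cast_sub h.le]
        exact_mod_cast by linarith
      have hq : (0 : ℝ) ≤ q - (i : ℕ) := sub_nonneg.2 (by exact_mod_cast h.le)
      -- Under the square root, the recursion `hC` for binomial coefficients converts one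
      -- normalization of the weight basis into the next.
      have hs : Real.sqrt ((((i : ℕ) + 1 : ℕ) : ℝ) * ((q : ℝ) + 1 - (((i : ℕ) + 1 : ℕ) : ℝ))) *
          Real.sqrt (q.choose ((i : ℕ) + 1)) = (q - (i : ℕ)) * Real.sqrt (q.choose i) := by
        rw [← Real.sqrt_mul (mul_nonneg (by positivity) (by push_cast; linarith)),
          show (((i : ℕ) + 1 : ℕ) : ℝ) * ((q : ℝ) + 1 - (((i : ℕ) + 1 : ℕ) : ℝ)) *
            (q.choose ((i : ℕ) + 1)) = (q - (i : ℕ)) ^ 2 * (q.choose i) by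
            push_cast; linear_combination (q - (i : ℕ) : ℝ) * hC,
          Real.sqrt_mul (sq_nonneg _), Real.sqrt_sq hq]
      have hs' := congrArg (fun x : ℝ => (x : ℂ)) hs
      simp only [spinPlus, Matrix.of_apply, if_true, coh, dcoh, Matrix.cons_val_zero,
        Pi.smul_apply, smul_eq_mul, Nat.cast_sub h.le]
      push_cast at hs' ⊢
      rw [show q - ((i : ℕ) + 1) = q - (i : ℕ) - 1 by omega, pow_succ]
      linear_combination (v 0 ^ (q - (i : ℕ) - 1) * (v 1 ^ (i : ℕ) * v 1)) * hs'
    · intro k _ hk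
      have : ¬ (k : ℕ) = i + 1 := fun h' => hk (Fin.ext h')
      simp [spinPlus, this]
    · simp
  · rw [Finset.sum_eq_zero]
    · simp [dcoh, show q - (i : ℕ) = 0 by omega]
    · intro k _
      have : ¬ (k : ℕ) = i + 1 := by omega
      simp [spinPlus, this]

theorem spinMinus_mulVec_coh (v : Fin 2 → ℂ) : spinMinus q *ᵥ coh q v = v 0 • dcoh q v 1 := by
  funext i
  have hi := i.isLt
  rw [Matrix.mulVec, dotProduct]
  by_cases h : (i : ℕ) = 0
  · rw [Finset.sum_eq_zero]
    · simp [dcoh, h]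
    · intro k _
      have : ¬ (i : ℕ) = k + 1 := by omega
      simp [spinMinus, spinPlus, this]
  · obtain ⟨r, hr⟩ := Nat.exists_eq_succ_of_ne_zero h
    rw [Nat.succ_eq_add_one] at hr
    rw [Finset.sum_eq_single ⟨r, by omega⟩]
    · have hrq : r ≤ q := by omega
      have hC : (r + 1 : ℝ) * (q.choose (r + 1) : ℝ) = (q - r) * (q.choose r : ℝ) := by
        have := Nat.choose_succ_right_eq q r
        rw [← Nat.cast_sub hrq]
        exact_mod_cast by linarith
      have hq : (0 : ℝ) ≤ q - r := sub_nonneg.2 (by exact_mod_cast hrq)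
      have hs : Real.sqrt (((r + 1 : ℕ) : ℝ) * ((q : ℝ) + 1 - ((r + 1 : ℕ) : ℝ))) *
          Real.sqrt (q.choose r) = (r + 1) * Real.sqrt (q.choose (r + 1)) := by
        rw [← Real.sqrt_mul (mul_nonneg (by positivity) (by push_cast; linarith)),
          show ((r + 1 : ℕ) : ℝ) * ((q : ℝ) + 1 - ((r + 1 : ℕ) : ℝ)) * (q.choose r) =
            (r + 1) ^ 2 * (q.choose (r + 1)) by
            push_cast; linear_combination -(r + 1 : ℝ) * hC,
          Real.sqrt_mul (sq_nonneg _), Real.sqrt_sq (by positivity)]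
      have hs' := congrArg (fun x : ℝ => (x : ℂ)) hs
      simp only [spinMinus, Matrix.transpose_apply, spinPlus, Matrix.of_apply, if_true, coh, dcoh,
        Matrix.cons_val_one, Pi.smul_apply, smul_eq_mul, hr, Nat.add_sub_cancel,
        Matrix.cons_val_fin_one]
      push_cast at hs' ⊢
      rw [show q - r = q - (r + 1) + 1 by omega, pow_succ]
      linear_combination (v 0 ^ (q - (r + 1)) * v 0 * v 1 ^ r) * hs'
    · intro k _ hk
      have : ¬ (i : ℕ) = k + 1 := fun h' => hk (Fin.ext (by simp; omega))
      simp [spinMinus, spinPlus, this]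
    · simp

theorem spinZ_mulVec_coh (v : Fin 2 → ℂ) :
    spinZ q *ᵥ coh q v = v 0 • dcoh q v 0 - ((q : ℂ) / 2) • coh q v := by
  funext i
  have hi : (i : ℕ) ≤ q := Nat.lt_succ_iff.1 i.isLt
  rw [spinZ, Matrix.mulVec_diagonal]
  simp only [coh, dcoh, Matrix.cons_val_zero, Pi.sub_apply, Pi.smul_apply, smul_eq_mul]
  obtain ⟨r, hr⟩ := Nat.exists_eq_add_of_le hi
  have hr' : q - (i : ℕ) = r := by omega
  rw [hr']
  have hq : (q : ℂ) = (i : ℕ) + r := by exact_mod_cast hr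
  rw [hq]
  cases r with
  | zero => simp; ring
  | succ r => rw [Nat.add_sub_cancel]; push_cast; ring

theorem neg_spinZ_mulVec_coh (v : Fin 2 → ℂ) :
    -spinZ q *ᵥ coh q v = v 1 • dcoh q v 1 - ((q : ℂ) / 2) • coh q v := by
  funext i
  rw [Matrix.neg_mulVec, spinZ, Pi.neg_apply, Matrix.mulVec_diagonal]
  simp only [coh, dcoh, Matrix.cons_val_one, Pi.sub_apply, Pi.smul_apply, smul_eq_mul,
    Matrix.cons_val_fin_one]
  cases h : (i : ℕ) with
  | zero => simp
  | succ r => rw [Nat.add_sub_cancel]; push_cast; ring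

/-- The generators act as `v_i ∂_j` on homogeneous polynomials of degree `q`; subtracting `q / 2` on
the diagonal makes them traceless. -/
theorem spinGen_mulVec_coh (v : Fin 2 → ℂ) (i j : Fin 2) : spinGen q i j *ᵥ coh q v =
    v i • dcoh q v j - ((1 : Matrix (Fin 2) (Fin 2) ℂ) i j * (q / 2)) • coh q v := by
  fin_cases i <;> fin_cases j
  · simpa [spinGen] using spinZ_mulVec_coh v
  · simpa [spinGen] using spinMinus_mulVec_coh v
  · simpa [spinGen] using spinPlus_mulVec_coh v
  · simpa [spinGen] using neg_spinZ_mulVec_coh v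

theorem mul_one_apply_comm (W : Matrix (Fin 2) (Fin 2) ℂ) (i j : Fin 2) :
    W i 0 * (1 : Matrix (Fin 2) (Fin 2) ℂ) 0 j + W i 1 * (1 : Matrix (Fin 2) (Fin 2) ℂ) 1 j =
      (1 : Matrix (Fin 2) (Fin 2) ℂ) i 0 * W 0 j + (1 : Matrix (Fin 2) (Fin 2) ℂ) i 1 * W 1 j := by
  rw [← Fin.sum_univ_two (f := fun k => W i k * (1 : Matrix (Fin 2) (Fin 2) ℂ) k j),
    ← Fin.sum_univ_two (f := fun k => (1 : Matrix (Fin 2) (Fin 2) ℂ) i k * W k j),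
    ← Matrix.mul_apply, ← Matrix.mul_apply, mul_one, one_mul]

/-- On coherent vectors `∑ W i k v_k` is the `i`-th coordinate of `W v`, while the chain rule
produces `∑ W l j ∂_l`. These are the two sides, up to the diagonal `q / 2` terms. -/
theorem fused_mul_spinGen (W : Matrix (Fin 2) (Fin 2) ℂ) (i j : Fin 2) :
    fused q W * ∑ k, W i k • spinGen q k j = (∑ l, W l j • spinGen q i l) * fused q W := by
  refine eq_of_mulVec_coh fun v => ?_
  rw [← Matrix.mulVec_mulVec, ← Matrix.mulVec_mulVec, fused_mulVec_coh]
  simp only [Matrix.add_mulVec, Matrix.smul_mulVec, spinGen_mulVec_coh, Fin.sum_univ_two,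
    Matrix.mulVec_add, Matrix.mulVec_sub, Matrix.mulVec_smul, fused_mulVec_coh, fused_mulVec_dcoh]
  have h : (W *ᵥ v) i = W i 0 * v 0 + W i 1 * v 1 := by
    simp [Matrix.mulVec, dotProduct, Fin.sum_univ_two]
  have h2 := congrArg (· • coh q (W *ᵥ v)) (mul_one_apply_comm W i j)
  simp only [add_smul] at h2
  rw [h]
  linear_combination (norm := module) (-(q : ℂ) / 2) • h2

end Fused

/-! ### The global twist -/

section Twist

variable {N : ℕ} {m : Fin N → ℕ} {η : ℂ} {ξ : Fin N → ℂ} {W : Matrix (Fin 2) (Fin 2) ℂ}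

theorem globalTwist_mul (W W' : Matrix (Fin 2) (Fin 2) ℂ) :
    globalTwist m (W * W') = globalTwist m W * globalTwist m W' := by
  ext i j
  simp only [globalTwist, Matrix.of_apply, fused_mul, Matrix.mul_apply]
  rw [Finset.prod_univ_sum, Fintype.piFinset_univ]
  simp only [Finset.prod_mul_distrib]

theorem globalTwist_one : globalTwist m 1 = 1 := by
  ext i j
  simp only [globalTwist, Matrix.of_apply, fused_one, Matrix.one_apply]
  by_cases h : i = j
  · subst h; simp
  · rw [if_neg h]
    obtain ⟨n, hn⟩ := Function.ne_iff.1 h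
    exact Finset.prod_eq_zero (Finset.mem_univ n) (if_neg hn)

theorem globalTwist_mul_inv (hW : IsUnit W.det) : globalTwist m W * globalTwist m W⁻¹ = 1 := by
  rw [← globalTwist_mul, Matrix.mul_nonsing_inv _ hW, globalTwist_one]

theorem globalTwist_det (hW : IsUnit W.det) : IsUnit (globalTwist m W).det :=
  Matrix.isUnit_det_of_right_inverse (globalTwist_mul_inv hW)

theorem globalTwist_mul_siteOp (n : Fin N) {X Y : Matrix (Fin (m n + 1)) (Fin (m n + 1)) ℂ}
    (h : fused (m n) W * X = Y * fused (m n) W) :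
    globalTwist m W * siteOp m n X = siteOp m n Y * globalTwist m W := by
  ext i j
  rw [mul_siteOp_apply, siteOp_mul_apply]
  have h1 : ∀ x, globalTwist m W i (Function.update j n x) =
      fused (m n) W (i n) x * ∏ p ∈ Finset.univ.erase n, fused (m p) W (i p) (j p) := by
    intro x
    rw [globalTwist, Matrix.of_apply, ← Finset.mul_prod_erase _ _ (Finset.mem_univ n),
      Function.update_self]
    congr 1
    exact Finset.prod_congr rfl fun p hp => by
      rw [Function.update_of_ne (Finset.ne_of_mem_erase hp)]
  have h2 : ∀ x, globalTwist m W (Function.update i n x) j =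
      fused (m n) W x (j n) * ∏ p ∈ Finset.univ.erase n, fused (m p) W (i p) (j p) := by
    intro x
    rw [globalTwist, Matrix.of_apply, ← Finset.mul_prod_erase _ _ (Finset.mem_univ n),
      Function.update_self]
    congr 1
    exact Finset.prod_congr rfl fun p hp => by
      rw [Function.update_of_ne (Finset.ne_of_mem_erase hp)]
  have h3 := congrFun (congrFun h (i n)) (j n)
  rw [Matrix.mul_apply, Matrix.mul_apply] at h3
  simp only [h1, h2]
  calc _ = (∑ x, fused (m n) W (i n) x * X x (j n)) *
        ∏ p ∈ Finset.univ.erase n, fused (m p) W (i p) (j p) := by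
        rw [Finset.sum_mul]; exact Finset.sum_congr rfl fun x _ => by ring
    _ = _ := by
        rw [h3, Finset.sum_mul]; exact Finset.sum_congr rfl fun x _ => by ring

theorem gen_eq (n : Fin N) (i j : Fin 2) : gen m n i j = siteOp m n (spinGen (m n) i j) := by
  fin_cases i <;> fin_cases j <;> simp [gen, spinGen]
  rw [← neg_one_smul ℂ (spinZ (m n)), siteOp_smul, neg_one_smul]

/-- The matrix `W` of the auxiliary space tensored with its symmetric powers at all sites. -/
def fullTwist (m : Fin N → ℕ) (W : Matrix (Fin 2) (Fin 2) ℂ) : Matrix (Fin 2) (Fin 2) (Op m) :=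
  W.map fun c => c • globalTwist m W

/-- A Lax operator is a scalar plus `η` times the invariant tensor of `gl₂` generators, and
`fused_mul_spinGen` is the invariance of that tensor in components. -/
theorem fullTwist_commute_lax (n : Fin N) (x : ℂ) :
    Commute (fullTwist m W) (lax m η n x) := by
  ext1 i j
  have h := globalTwist_mul_siteOp (m := m) n (fused_mul_spinGen (q := m n) W i j)
  simp only [Fin.sum_univ_two, siteOp_add, siteOp_smul, ← gen_eq] at h
  rw [lax_eq, Matrix.mul_apply, Matrix.mul_apply]
  simp only [fullTwist, Matrix.map_apply, Matrix.of_apply, Fin.sum_univ_two, mul_add, add_mul,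
    mul_one, one_mul, mul_smul_comm, smul_mul_assoc] at h ⊢
  have h3 := congrArg (· • globalTwist m W) (mul_one_apply_comm W i j)
  simp only [add_smul] at h3
  linear_combination (norm := module) η • h + (x + η / 2) • h3

theorem fullTwist_mul_monodromy (hW : IsUnit W.det) (K : Matrix (Fin 2) (Fin 2) ℂ) (x : ℂ) :
    fullTwist m W * monodromy m η ξ (W⁻¹ * K * W) x = monodromy m η ξ K x * fullTwist m W := by
  have h1 : fullTwist m W * aux m (W⁻¹ * K * W) = aux m K * fullTwist m W := by
    ext1 i j
    have h : W * (W⁻¹ * K * W) = K * W := by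
      rw [mul_assoc W⁻¹, ← mul_assoc, Matrix.mul_nonsing_inv _ hW, one_mul]
    have h' := congrFun (congrFun h i) j
    rw [Matrix.mul_apply, Matrix.mul_apply] at h'
    rw [Matrix.mul_apply, Matrix.mul_apply]
    simp only [fullTwist, aux, Matrix.map_apply, smul_mul_smul_comm, mul_one, one_mul,
      ← Finset.sum_smul, h']
  have h2 : Commute (fullTwist m W) (laxProd m η ξ (List.finRange N).reverse x) :=
    Commute.list_prod_right _ _ fun y hy => by
      obtain ⟨n, -, rfl⟩ := List.mem_map.1 hy
      exact fullTwist_commute_lax n _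
  rw [monodromy_eq, monodromy_eq, ← mul_assoc, h1, mul_assoc, h2.eq, mul_assoc]

/-- Multiplying `fullTwist_mul_monodromy` by `W⁻¹` on the auxiliary space isolates the entry `l j`
of `W⁻¹ M W`. As a trace against `M` this entry requires the transposed matrix unit, whence
`Matrix.single j l`. -/
theorem tildeOp_mul_globalTwist (hW : IsUnit W.det) (K : Matrix (Fin 2) (Fin 2) ℂ) (x : ℂ)
    (l j : Fin 2) : tildeOp m η ξ K W (Matrix.single j l 1) x * globalTwist m W =
      globalTwist m W * monodromy m η ξ (W⁻¹ * K * W) x l j := by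
  have h : ∀ i, ∑ k, W i k • (globalTwist m W * monodromy m η ξ (W⁻¹ * K * W) x k j) =
      ∑ k, W k j • (monodromy m η ξ K x i k * globalTwist m W) := by
    intro i
    have := congrFun (congrFun (fullTwist_mul_monodromy (m := m) (η := η) (ξ := ξ) hW K x) i) j
    rw [Matrix.mul_apply, Matrix.mul_apply] at this
    simpa only [fullTwist, Matrix.map_apply, smul_mul_assoc, mul_smul_comm] using this
  have h1 : ∑ i, W⁻¹ l i • ∑ k, W i k •
      (globalTwist m W * monodromy m η ξ (W⁻¹ * K * W) x k j) =
      globalTwist m W * monodromy m η ξ (W⁻¹ * K * W) x l j := by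
    have h2 : ∀ k, ∑ i, W⁻¹ l i * W i k = (1 : Matrix (Fin 2) (Fin 2) ℂ) l k := by
      intro k
      rw [← Matrix.nonsing_inv_mul _ hW, Matrix.mul_apply]
    simp only [Finset.smul_sum, smul_smul]
    rw [Finset.sum_comm]
    simp only [← Finset.sum_smul, h2]
    simp [Matrix.one_apply]
  rw [← h1]
  simp only [h]
  have h3 : ∀ a b, (W * Matrix.single j l (1 : ℂ) * W⁻¹) a b = W a j * W⁻¹ l b := by
    intro a b
    fin_cases j <;> fin_cases l <;>
      simp [Matrix.mul_apply, Fin.sum_univ_two, Matrix.single_apply]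
  have h4 : ∀ X Y, Matrix.trace (aux m X * Y) = ∑ a, ∑ b, X a b • Y b a := by
    intro X Y
    simp [Matrix.trace, Matrix.mul_apply, aux]
  rw [tildeOp, h4]
  simp only [h3, Fin.sum_univ_two, add_mul, smul_mul_assoc]
  module

theorem single_zero_zero : (!![1, 0; 0, 0] : Matrix (Fin 2) (Fin 2) ℂ) = Matrix.single 0 0 1 := by
  ext i j; fin_cases i <;> fin_cases j <;> simp

theorem single_one_zero : (!![0, 0; 1, 0] : Matrix (Fin 2) (Fin 2) ℂ) = Matrix.single 1 0 1 := by
  ext i j; fin_cases i <;> fin_cases j <;> simp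

theorem single_one_one : (!![0, 0; 0, 1] : Matrix (Fin 2) (Fin 2) ℂ) = Matrix.single 1 1 1 := by
  ext i j; fin_cases i <;> fin_cases j <;> simp

variable {K : Matrix (Fin 2) (Fin 2) ℂ}

theorem tildeA_mul_globalTwist (hW : IsUnit W.det) (x : ℂ) :
    tildeA m η ξ K W x * globalTwist m W = globalTwist m W * opA m η ξ (W⁻¹ * K * W) x := by
  rw [tildeA, single_zero_zero, tildeOp_mul_globalTwist hW, opA]

theorem tildeB_mul_globalTwist (hW : IsUnit W.det) (x : ℂ) :
    tildeB m η ξ K W x * globalTwist m W = globalTwist m W * opB m η ξ (W⁻¹ * K * W) x := by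
  rw [tildeB, single_one_zero, tildeOp_mul_globalTwist hW, opB]

theorem tildeD_mul_globalTwist (hW : IsUnit W.det) (x : ℂ) :
    tildeD m η ξ K W x * globalTwist m W = globalTwist m W * opD m η ξ (W⁻¹ * K * W) x := by
  rw [tildeD, single_one_one, tildeOp_mul_globalTwist hW, opD]

theorem inv_globalTwist_mul (hW : IsUnit W.det) {X Y : Op m}
    (h : X * globalTwist m W = globalTwist m W * Y) :
    (globalTwist m W)⁻¹ * X = Y * (globalTwist m W)⁻¹ := by
  have hT := globalTwist_det (m := m) hW
  calc (globalTwist m W)⁻¹ * X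
      = (globalTwist m W)⁻¹ * (X * globalTwist m W) * (globalTwist m W)⁻¹ := by
        rw [mul_assoc, mul_assoc X, Matrix.mul_nonsing_inv _ hT, mul_one]
    _ = _ := by rw [h, ← mul_assoc, Matrix.nonsing_inv_mul _ hT, one_mul]

theorem vecMul_inv_globalTwist (hW : IsUnit W.det) {X Y : Op m}
    (h : X * globalTwist m W = globalTwist m W * Y) (u : Conf m → ℂ) :
    (u ᵥ* (globalTwist m W)⁻¹) ᵥ* X = (u ᵥ* Y) ᵥ* (globalTwist m W)⁻¹ := by
  rw [Matrix.vecMul_vecMul, Matrix.vecMul_vecMul, inv_globalTwist_mul hW h]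

theorem semiconjBy_prod_ofFn {M : Type*} [Monoid M] {n : ℕ} {a : M} {f g : Fin n → M}
    (h : ∀ i, SemiconjBy a (f i) (g i)) :
    SemiconjBy a (List.ofFn f).prod (List.ofFn g).prod := by
  induction n with
  | zero => simp
  | succ n ih =>
    rw [List.ofFn_succ, List.ofFn_succ, List.prod_cons, List.prod_cons]
    exact (h 0).mul_right (ih fun i => h i.succ)

theorem ladder_mul_globalTwist {k₁ : ℂ} {F G : ℂ → Op m}
    (h : ∀ x, F x * globalTwist m W = globalTwist m W * G x) (c : Conf m) :
    ladder m η ξ k₁ F c * globalTwist m W = globalTwist m W * ladder m η ξ k₁ G c := by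
  refine Eq.symm (semiconjBy_prod_ofFn (a := globalTwist m W) fun n =>
    semiconjBy_prod_ofFn fun k => ?_)
  rw [SemiconjBy, mul_smul_comm, smul_mul_assoc, h]

theorem shift_vecMul (v : Conf m → Conf m → ℂ) (Y : Op m) (h : Conf m) (r : Fin N) (e : ℤ) :
    shift (fun g => v g ᵥ* Y) h r e = shift v h r e ᵥ* Y := by
  unfold shift
  split_ifs
  · rfl
  · rw [Matrix.zero_vecMul]

/-- A lower triangular non-scalar matrix is conjugate to one without zeros off the diagonal. -/
theorem exists_conj_offDiag_ne_zero (hK : ∀ α : ℂ, K ≠ α • (1 : Matrix (Fin 2) (Fin 2) ℂ))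
    (hb : K 0 1 = 0) : ∃ W : Matrix (Fin 2) (Fin 2) ℂ, IsUnit W.det ∧
      (W⁻¹ * K * W) 0 1 ≠ 0 ∧ (W⁻¹ * K * W) 1 0 ≠ 0 := by
  -- Take `W` with columns `(1, r)` and `(1, s)`; the conditions say that they are independent and
  -- that neither is an eigenvector of `K`.
  have key : ∀ r s : ℂ, s - r ≠ 0 → s * (K 0 0 - K 1 1) - K 1 0 ≠ 0 →
      K 1 0 - r * (K 0 0 - K 1 1) ≠ 0 → ∃ W : Matrix (Fin 2) (Fin 2) ℂ, IsUnit W.det ∧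
      (W⁻¹ * K * W) 0 1 ≠ 0 ∧ (W⁻¹ * K * W) 1 0 ≠ 0 := by
    intro r s h1 h2 h3
    have hdet : (!![1, 1; r, s] : Matrix (Fin 2) (Fin 2) ℂ).det = s - r := by
      simp [Matrix.det_fin_two]
    refine ⟨!![1, 1; r, s], by rw [hdet]; exact h1.isUnit, ?_, ?_⟩
    · have : ((!![1, 1; r, s] : Matrix (Fin 2) (Fin 2) ℂ)⁻¹ * K * !![1, 1; r, s]) 0 1 =
          (s - r)⁻¹ * (s * (K 0 0 - K 1 1) - K 1 0) := by
        rw [Matrix.inv_def, hdet, Matrix.adjugate_fin_two_of]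
        simp [Matrix.mul_apply, Matrix.vecMul, dotProduct, Fin.sum_univ_two, hb]
        ring
      rw [this]
      exact mul_ne_zero (inv_ne_zero h1) h2
    · have : ((!![1, 1; r, s] : Matrix (Fin 2) (Fin 2) ℂ)⁻¹ * K * !![1, 1; r, s]) 1 0 =
          (s - r)⁻¹ * (K 1 0 - r * (K 0 0 - K 1 1)) := by
        rw [Matrix.inv_def, hdet, Matrix.adjugate_fin_two_of]
        simp [Matrix.mul_apply, Matrix.vecMul, dotProduct, Fin.sum_univ_two, hb]
        ring
      rw [this]
      exact mul_ne_zero (inv_ne_zero h1) h3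
  by_cases hd : K 0 0 - K 1 1 = 0
  · have hc : K 1 0 ≠ 0 := by
      intro hc
      refine hK (K 0 0) ?_
      ext i j
      fin_cases i <;> fin_cases j <;> simp [hb, hc, (sub_eq_zero.1 hd).symm]
    exact key 0 1 (by simp) (by simpa [hd] using hc) (by simpa using hc)
  -- The only eigenvector with first coordinate `1` has slope `K 1 0 / (K 0 0 - K 1 1)`; any two
  -- other distinct slopes would do.
  · refine key (K 1 0 / (K 0 0 - K 1 1) + 1) (K 1 0 / (K 0 0 - K 1 1) + 2) (by norm_num) ?_ ?_
    · have : (K 1 0 / (K 0 0 - K 1 1) + 2) * (K 0 0 - K 1 1) - K 1 0 = 2 * (K 0 0 - K 1 1) := by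
        field_simp; ring
      rw [this]
      exact mul_ne_zero two_ne_zero hd
    · have : K 1 0 - (K 1 0 / (K 0 0 - K 1 1) + 1) * (K 0 0 - K 1 1) = -(K 0 0 - K 1 1) := by
        field_simp; ring
      rw [this]
      exact neg_ne_zero.2 hd

end Twist

end HigherSpin

end

theorem theorem3p2 {N : ℕ} (m : Fin N → ℕ) (hm : ∀ n, 0 < m n) (η : ℂ) (hη : η ≠ 0)
    (ξ : Fin N → ℂ)
    (hξ : ∀ a b : Fin N, a ≠ b → ∀ z : ℤ, ξ a ≠ ξ b + (z : ℂ) * η)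
    (hnode : ∀ a b : Fin N, a ≠ b → ∀ k ≤ m a, ∀ l ≤ m b,
      HigherSpin.node m η ξ a k ≠ HigherSpin.node m η ξ b l)
    (K : Matrix (Fin 2) (Fin 2) ℂ) (hK : ∀ α : ℂ, K ≠ α • (1 : Matrix (Fin 2) (Fin 2) ℂ))
    (hdet : IsUnit K.det) (k₁ k₂ : ℂ) (hk : K.charpoly.roots = {k₁, k₂}) :
    -- part a
    (K 0 1 ≠ 0 →
      -- a basis of eigencovectors with distinct eigenvalues
      (LinearIndependent ℂ (HigherSpin.skCovector m η ξ K k₁) ∧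
        Submodule.span ℂ (Set.range (HigherSpin.skCovector m η ξ K k₁)) = ⊤) ∧
      (∀ (h : HigherSpin.Conf m) (lam : ℂ),
        HigherSpin.skCovector m η ξ K k₁ h ᵥ* HigherSpin.opB m η ξ K lam =
          HigherSpin.eigB m η ξ (K 0 1) h lam • HigherSpin.skCovector m η ξ K k₁ h) ∧
      Function.Injective (HigherSpin.eigB m η ξ (K 0 1)) ∧
      -- the action of A and D
      (∀ (h : HigherSpin.Conf m) (lam : ℂ),
        HigherSpin.skCovector m η ξ K k₁ h ᵥ* HigherSpin.opA m η ξ K lam =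
          (K 0 0 * ∏ n, (lam - HigherSpin.node m η ξ n (h n))) •
              HigherSpin.skCovector m η ξ K k₁ h +
            ∑ a, (HigherSpin.interp m η ξ h a lam *
                (k₁ * HigherSpin.funA m η ξ (HigherSpin.node m η ξ a (h a)))) •
              HigherSpin.shift (HigherSpin.skCovector m η ξ K k₁) h a 1) ∧
      (∀ (h : HigherSpin.Conf m) (lam : ℂ),
        HigherSpin.skCovector m η ξ K k₁ h ᵥ* HigherSpin.opD m η ξ K lam =
          (K 1 1 * ∏ n, (lam - HigherSpin.node m η ξ n (h n))) •
              HigherSpin.skCovector m η ξ K k₁ h +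
            ∑ a, (HigherSpin.interp m η ξ h a lam *
                (k₂ * HigherSpin.funD m η ξ (HigherSpin.node m η ξ a (h a)))) •
              HigherSpin.shift (HigherSpin.skCovector m η ξ K k₁) h a (-1)) ∧
      -- C is uniquely determined by the quantum determinant relation
      (∀ lam : ℂ,
        HigherSpin.opA m η ξ K lam * HigherSpin.opD m η ξ K (lam - η) -
            HigherSpin.opB m η ξ K lam * HigherSpin.opC m η ξ K (lam - η) =
          (K.det * (HigherSpin.funA m η ξ lam * HigherSpin.funD m η ξ (lam - η))) •
            (1 : HigherSpin.Op m)) ∧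
      (∀ X : ℂ → HigherSpin.Op m, Continuous X →
        (∀ lam : ℂ,
          HigherSpin.opA m η ξ K lam * HigherSpin.opD m η ξ K (lam - η) -
              HigherSpin.opB m η ξ K lam * X (lam - η) =
            (K.det * (HigherSpin.funA m η ξ lam * HigherSpin.funD m η ξ (lam - η))) •
              (1 : HigherSpin.Op m)) →
        X = HigherSpin.opC m η ξ K)) ∧
    -- part b
    (K 0 1 = 0 →
      (∃ W : Matrix (Fin 2) (Fin 2) ℂ, IsUnit W.det ∧
        (W⁻¹ * K * W) 0 1 ≠ 0 ∧ (W⁻¹ * K * W) 1 0 ≠ 0) ∧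
      ∀ W : Matrix (Fin 2) (Fin 2) ℂ, IsUnit W.det → (W⁻¹ * K * W) 0 1 ≠ 0 →
        -- the two expressions of the covectors
        (∀ h : HigherSpin.Conf m,
          HigherSpin.skCovectorTilde m η ξ K W k₁ h =
            (HigherSpin.normalization m η ξ)⁻¹ •
              ((HigherSpin.refCovector m ᵥ* (HigherSpin.globalTwist m W)⁻¹) ᵥ*
                HigherSpin.ladder m η ξ k₁ (HigherSpin.tildeA m η ξ K W) h)) ∧
        -- a basis of eigencovectors with distinct eigenvalues
        (LinearIndependent ℂ (HigherSpin.skCovectorTilde m η ξ K W k₁) ∧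
          Submodule.span ℂ (Set.range (HigherSpin.skCovectorTilde m η ξ K W k₁)) = ⊤) ∧
        (∀ (h : HigherSpin.Conf m) (lam : ℂ),
          HigherSpin.skCovectorTilde m η ξ K W k₁ h ᵥ* HigherSpin.tildeB m η ξ K W lam =
            HigherSpin.eigB m η ξ ((W⁻¹ * K * W) 0 1) h lam •
              HigherSpin.skCovectorTilde m η ξ K W k₁ h) ∧
        Function.Injective (HigherSpin.eigB m η ξ ((W⁻¹ * K * W) 0 1)) ∧
        -- the action of the transformed A and D
        (∀ (h : HigherSpin.Conf m) (lam : ℂ),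
          HigherSpin.skCovectorTilde m η ξ K W k₁ h ᵥ* HigherSpin.tildeA m η ξ K W lam =
            ((W⁻¹ * K * W) 0 0 * ∏ n, (lam - HigherSpin.node m η ξ n (h n))) •
                HigherSpin.skCovectorTilde m η ξ K W k₁ h +
              ∑ a, (HigherSpin.interp m η ξ h a lam *
                  (k₁ * HigherSpin.funA m η ξ (HigherSpin.node m η ξ a (h a)))) •
                HigherSpin.shift (HigherSpin.skCovectorTilde m η ξ K W k₁) h a 1) ∧
        (∀ (h : HigherSpin.Conf m) (lam : ℂ),
          HigherSpin.skCovectorTilde m η ξ K W k₁ h ᵥ* HigherSpin.tildeD m η ξ K W lam =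
            ((W⁻¹ * K * W) 1 1 * ∏ n, (lam - HigherSpin.node m η ξ n (h n))) •
                HigherSpin.skCovectorTilde m η ξ K W k₁ h +
              ∑ a, (HigherSpin.interp m η ξ h a lam *
                  (k₂ * HigherSpin.funD m η ξ (HigherSpin.node m η ξ a (h a)))) •
                HigherSpin.shift (HigherSpin.skCovectorTilde m η ξ K W k₁) h a (-1))) := by
  -- The eigenvalues enter only through their product, which is also why their order does not
  -- matter.
  have hkdet : k₁ * k₂ = K.det := by
    rw [Matrix.det_eq_prod_roots_charpoly, hk, Multiset.insert_eq_cons, Multiset.prod_cons,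
      Multiset.prod_singleton]
  refine ⟨fun hb => ?_, fun hb => ⟨HigherSpin.exists_conj_offDiag_ne_zero hK hb,
    fun W hW hb' => ?_⟩⟩
  · have hd := hdet.ne_zero
    have hk₁ : k₁ ≠ 0 := fun h => hd (by rw [← hkdet, h, zero_mul])
    exact ⟨⟨HigherSpin.skCovector_linearIndependent hη hnode hkdet hd hb,
        HigherSpin.skCovector_span hη hnode hkdet hd hb⟩,
      HigherSpin.skCovector_vecMul_opB hη hnode hk₁,
      HigherSpin.eigB_injective hη hnode hb,
      HigherSpin.skCovector_vecMul_opA hη hnode hkdet hd hb,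
      HigherSpin.skCovector_vecMul_opD hη hnode hkdet hd hb,
      HigherSpin.opA_mul_opD,
      fun X hX h => HigherSpin.opC_unique hη hnode hkdet hd hb hX h⟩
  -- Conjugation preserves the determinant, so the case `b ≠ 0` applies to `W⁻¹ K W` with the same
  -- `k₁`, `k₂`; the result is then carried over by the invertible `globalTwist`.
  · have hdet' : (W⁻¹ * K * W).det = K.det :=
      Matrix.det_conj' ((Matrix.isUnit_iff_isUnit_det W).2 hW) K
    have hkdet' : k₁ * k₂ = (W⁻¹ * K * W).det := hkdet.trans hdet'.symm
    have hd : (W⁻¹ * K * W).det ≠ 0 := hdet' ▸ hdet.ne_zero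
    have hk₁ : k₁ ≠ 0 := fun h => hd (by rw [← hkdet', h, zero_mul])
    have hli : LinearIndependent ℂ (HigherSpin.skCovectorTilde m η ξ K W k₁) := by
      refine (HigherSpin.skCovector_linearIndependent hη hnode hkdet' hd hb').map'
        (Matrix.vecMulLinear (HigherSpin.globalTwist m W)⁻¹) (LinearMap.ker_eq_bot.2 ?_)
      exact Matrix.vecMul_injective_of_isUnit ((Matrix.isUnit_iff_isUnit_det _).2
        (Matrix.isUnit_nonsing_inv_det _ (HigherSpin.globalTwist_det hW)))
    have hshift : ∀ h a e, HigherSpin.shift (HigherSpin.skCovectorTilde m η ξ K W k₁) h a e =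
        HigherSpin.shift (HigherSpin.skCovector m η ξ (W⁻¹ * K * W) k₁) h a e ᵥ*
          (HigherSpin.globalTwist m W)⁻¹ := fun h a e => HigherSpin.shift_vecMul _ _ h a e
    refine ⟨fun h => ?_, ⟨hli, hli.span_eq_top_of_card_eq_finrank'
      (Module.finrank_fintype_fun_eq_card ℂ).symm⟩, fun h x => ?_,
      HigherSpin.eigB_injective hη hnode hb', fun h x => ?_, fun h x => ?_⟩
    · rw [HigherSpin.vecMul_inv_globalTwist hW (HigherSpin.ladder_mul_globalTwist
        (HigherSpin.tildeA_mul_globalTwist hW) h), HigherSpin.skCovectorTilde,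
        HigherSpin.skCovector, Matrix.smul_vecMul]
    · rw [HigherSpin.skCovectorTilde, HigherSpin.vecMul_inv_globalTwist hW
        (HigherSpin.tildeB_mul_globalTwist hW x), HigherSpin.skCovector_vecMul_opB hη hnode hk₁,
        Matrix.smul_vecMul]
    · simp only [hshift]
      rw [HigherSpin.skCovectorTilde, HigherSpin.vecMul_inv_globalTwist hW
        (HigherSpin.tildeA_mul_globalTwist hW x),
        HigherSpin.skCovector_vecMul_opA hη hnode hkdet' hd hb', Matrix.add_vecMul,
        Matrix.smul_vecMul, Matrix.sum_vecMul]
      simp only [Matrix.smul_vecMul]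
    · simp only [hshift]
      rw [HigherSpin.skCovectorTilde, HigherSpin.vecMul_inv_globalTwist hW
        (HigherSpin.tildeD_mul_globalTwist hW x),
        HigherSpin.skCovector_vecMul_opD hη hnode hkdet' hd hb', Matrix.add_vecMul,
        Matrix.smul_vecMul, Matrix.sum_vecMul]
      simp only [Matrix.smul_vecMul]
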